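/- Theorem 4 (one-shot classical coding theorem). All Hilbert spaces are finite-dimensional. Let $A,B$ be quantum systems, $d_A=\dim\mathcal H_A\ge 2$, and let $\mathcal T_{A\to B}$ be a trace preserving completely positive map which is classical-quantum with respect to a fixed orthonormal basis $\{|i\rangle\}$ of $\mathcal H_A$; that is, its Choi-Jamiołkowski representation $\omega_{AB}=(\mathcal T_{A'\to B}\otimes\mathcal I_{A})(\Phi_{A'A})$, where $A'$ is a copy of $A$ and $\Phi_{A'A}=\frac1{d_A}\sum_{i,j}|i\rangle\langle j|\otimes|i\rangle\langle j|$, satisfies $\omega_{AB}=\sum_i(|i\rangle\langle i|\otimes 1)\,\omega_{AB}\,(|i\rangle\langle i|\otimes 1)$. Let $M$ be a message system with $d_M\le d_A$ and a fixed orthonormal basis, embedded in $A$ by identifying its basis vectors with distinct basis vectors of $A$, let $R$ and $\widehat M$ be copies of $M$, let $(\lambda_i)$ be a probability distribution, and put $|\varphi\rangle_{MR}=\sum_i\sqrt{\lambda_i}\,|i\rangle_M|i\rangle_R$, $\varphi_{MR}=|\varphi\rangle\langle\varphi|$ and $\varphi^{\rm cl}_{\widehat MR}=\sum_i\lambda_i\,|i\rangle\langle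 i|_{\widehat M}\otimes|i\rangle\langle i|_R$. Let $0\le\varepsilon<1$. Then there exist a permutation operator $P_A$ of the basis of $A$ and a trace preserving completely positive map (decoder) $\mathcal D_{B\to\widehat M}$ such that $$\Big\|\big((\mathcal D\circ\mathcal T)\otimes\mathcal I_R\big)\big(P_A\,\varphi_{MR}\,P_A^\dagger\big)-\varphi^{\rm cl}_{\widehat MR}\Big\|_1\le 2\sqrt{\sqrt{\frac{1}{d_A-1}\,2^{H_{\max}^{\varepsilon}(A|B)_\omega+H_{\max}(M)_\varphi}}+8\varepsilon}.$$ Here $\|X\|_1=\mathrm{tr}\sqrt{X^\dagger X}$, and the entropies are defined as follows. For a nonzero subnormalized state $\rho_{AC}$, $H_{\min}(A|C)_\rho$ is the largest real $\mu$ such that $\rho_{AC}\le 2^{-\mu}\,1_A\otimes\sigma_C$ for some state $\sigma_C$. $H^\varepsilon_{\min}(A|C)_\rho$ is the maximum of $H_{\min}(A|C)_{\tilde\rho}$ over the subnormalized states $\tilde\rho_{AC}$ with $\sqrt{1-\bar F(\rho,\tilde\rho)^2}\le\varepsilon$, where $\bar F(\rho,\tilde\rho)=\|\sqrt\rho\sqrt{\tilde\rho}\|_1+\sqrt{(1-\mathrm{tr}\,\rho)(1-\mathrm{tr}\,\tilde\rho)}$.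 Further, $H^\varepsilon_{\max}(A|B)_\rho=-H^\varepsilon_{\min}(A|C)_\rho$ and $H_{\max}(A|B)_\rho=-H_{\min}(A|C)_\rho$ for a purification $\rho_{ABC}$ of $\rho_{AB}$ (the value does not depend on the purification), and $H_{\max}(M)$ is the case of a trivial system $B$. -/

import Mathlib

open scoped Matrix Kronecker ComplexOrder MatrixOrder

/-!
Finite-dimensional quantum systems with a distinguished orthonormal basis are modelled by finite
types: the system `A` has Hilbert space `ℂ^A`, operators on it are `Matrix A A ℂ`, and the joint
system `AB` is `A × B`.
-/

namespace OneShot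

noncomputable section

universe u v w

section Definitions

variable {A : Type u} {B : Type v} {C : Type w}
variable [Fintype A] [DecidableEq A] [Fintype B] [DecidableEq B] [Fintype C] [DecidableEq C]

/-! ### States -/

/-- Normalized quantum states (density matrices). -/
def IsState (ρ : Matrix A A ℂ) : Prop := ρ.PosSemidef ∧ ρ.trace = 1

/-- Subnormalized quantum states. -/
def IsSubState (ρ : Matrix A A ℂ) : Prop := ρ.PosSemidef ∧ ρ.trace ≤ 1

/-- The operator `|ψ⟩⟨ψ|`. -/
def pureState (ψ : A → ℂ) : Matrix A A ℂ := Matrix.vecMulVec ψ (star ψ)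

/-- Partial trace over the second factor: `ρ_A = tr_B ρ_AB`. -/
def partialTrace (ρ : Matrix (A × B) (A × B) ℂ) : Matrix A A ℂ :=
  Matrix.of fun a a' => ∑ b, ρ (a, b) (a', b)

/-- `ρ_AB ↦ (𝒞_A ⊗ ℐ_B)(ρ_AB)` with `𝒞(X) = ∑ i, |i⟩⟨i| X |i⟩⟨i|`: all the blocks that are
off-diagonal in the basis of the first factor are removed. -/
def classicalize (ρ : Matrix (A × B) (A × B) ℂ) : Matrix (A × B) (A × B) ℂ :=
  Matrix.of fun x y => if x.1 = y.1 then ρ x y else 0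

/-! ### Channels -/

/-- The map `T ⊗ ℐ_R`. -/
def amplify (T : Matrix A A ℂ →ₗ[ℂ] Matrix B B ℂ) (R : Type*)
    (X : Matrix (A × R) (A × R) ℂ) : Matrix (B × R) (B × R) ℂ :=
  Matrix.of fun x y => T (Matrix.of fun a a' => X (a, x.2) (a', y.2)) x.1 y.1

/-- Quantum channels: trace preserving completely positive maps. -/
structure IsChannel (T : Matrix A A ℂ →ₗ[ℂ] Matrix B B ℂ) : Prop where
  completely_positive : ∀ (n : ℕ) (X : Matrix (A × Fin n) (A × Fin n) ℂ),
    X.PosSemidef → (amplify T (Fin n) X).PosSemidef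
  trace_preserving : ∀ X : Matrix A A ℂ, (T X).trace = X.trace

/-- The maximally entangled state `Φ_{AA'} = (1 / d_A) ∑ i j, |i⟩⟨j| ⊗ |i⟩⟨j|`. -/
def maxEntangled (A : Type u) [Fintype A] [DecidableEq A] : Matrix (A × A) (A × A) ℂ :=
  ((Fintype.card A : ℂ)⁻¹) •
    ∑ i : A, ∑ j : A, (Matrix.single i j (1 : ℂ)) ⊗ₖ (Matrix.single i j (1 : ℂ))

/-- The Choi-Jamiołkowski representation `ω_{A'B} = (T_{A → B} ⊗ ℐ_{A'})(Φ_{AA'})`, with the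
copy `A'` of the input written as the first factor. -/
def choi (T : Matrix A A ℂ →ₗ[ℂ] Matrix B B ℂ) : Matrix (A × B) (A × B) ℂ :=
  (amplify T A (maxEntangled A)).submatrix Prod.swap Prod.swap

/-- `T` is a classical-quantum map, with respect to the distinguished basis of its input: its
Choi-Jamiołkowski representation is classical on the input copy. -/
def IsCQ (T : Matrix A A ℂ →ₗ[ℂ] Matrix B B ℂ) : Prop := classicalize (choi T) = choi T

/-! ### Distances -/

/-- The Schatten 1-norm `‖X‖₁ = tr √(X† X)`. -/
def traceNorm (X : Matrix A A ℂ) : ℝ := (CFC.sqrt (Xᴴ * X)).trace.re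

/-- The fidelity `F(ρ, σ) = ‖√ρ √σ‖₁`. -/
def fidelity (ρ σ : Matrix A A ℂ) : ℝ := traceNorm (CFC.sqrt ρ * CFC.sqrt σ)

/-- The generalized fidelity of subnormalized states. -/
def genFidelity (ρ σ : Matrix A A ℂ) : ℝ :=
  fidelity ρ σ + √((1 - ρ.trace.re) * (1 - σ.trace.re))

/-- The purified distance of subnormalized states. -/
def purifiedDistance (ρ σ : Matrix A A ℂ) : ℝ := √(1 - genFidelity ρ σ ^ 2)

/-! ### Entropies -/

/-- The conditional min-entropy `H_min(A|B)_ρ` of a nonzero subnormalized state: the largest `lam`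
with `ρ_AB ≤ 2 ^ (-lam) 1_A ⊗ σ_B` for some state `σ_B`. (For `B` nonempty and `ρ ≠ 0` the set
below is nonempty and bounded above.) -/
def minEntropy (ρ : Matrix (A × B) (A × B) ℂ) : ℝ :=
  sSup {lam : ℝ | ∃ σ : Matrix B B ℂ, IsState σ ∧
    ρ ≤ ((2 : ℝ) ^ (-lam)) • ((1 : Matrix A A ℂ) ⊗ₖ σ)}

/-- The smooth conditional min-entropy `H_min^ε(A|B)_ρ`, for `0 ≤ ε < √(tr ρ)`: the maximum of the
min-entropies of all subnormalized states that are `ε`-close to `ρ` in purified distance. -/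
def smoothMinEntropy (ε : ℝ) (ρ : Matrix (A × B) (A × B) ℂ) : ℝ :=
  sSup (minEntropy '' {ρ' | IsSubState ρ' ∧ purifiedDistance ρ ρ' ≤ ε})

/-- The standard purification `(√ρ ⊗ 1) ∑ i, |i⟩|i⟩` of `ρ`; the purifying system is a copy. -/
def purify (ρ : Matrix A A ℂ) : A × A → ℂ := fun x => CFC.sqrt ρ x.1 x.2

/-- The vector `purify ρ` is a purification of `ρ`. -/
theorem partialTrace_purify (ρ : Matrix A A ℂ) (hρ : ρ.PosSemidef) :
    partialTrace (pureState (purify ρ)) = ρ := by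
  have h1 : CFC.sqrt ρ * CFC.sqrt ρ = ρ := CFC.sqrt_mul_sqrt_self ρ hρ.nonneg
  have h2 : (CFC.sqrt ρ)ᴴ = CFC.sqrt ρ := (Matrix.nonneg_iff_posSemidef.mp (CFC.sqrt_nonneg ρ)).isHermitian
  ext a a'
  conv_rhs => rw [← h1]
  rw [Matrix.mul_apply]
  simp only [partialTrace, pureState, purify, Matrix.of_apply, Matrix.vecMulVec_apply,
    Pi.star_apply]
  refine Finset.sum_congr rfl fun b _ => ?_
  rw [← Matrix.conjTranspose_apply, h2]

/-- The reduced state on `AC` of a vector on `(AB)C`. -/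
def reducedAC (ψ : (A × B) × C → ℂ) : Matrix (A × C) (A × C) ℂ :=
  partialTrace ((pureState ψ).submatrix
    (fun x : (A × C) × B => ((x.1.1, x.2), x.1.2)) (fun x => ((x.1.1, x.2), x.1.2)))

/-- The conditional max-entropy `H_max(A|B)_ρ = - H_min(A|C)_ρ`, where `ρ_ABC` is a purification
of `ρ_AB`. -/
def maxEntropy (ρ : Matrix (A × B) (A × B) ℂ) : ℝ :=
  - minEntropy (reducedAC (purify ρ))

/-- The smooth conditional max-entropy `H_max^ε(A|B)_ρ = - H_min^ε(A|C)_ρ`, where `ρ_ABC` is a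
purification of `ρ_AB`. -/
def smoothMaxEntropy (ε : ℝ) (ρ : Matrix (A × B) (A × B) ℂ) : ℝ :=
  - smoothMinEntropy ε (reducedAC (purify ρ))

/-- The unconditional max-entropy `H_max(A)_ρ`: the case of a trivial system `B`. -/
def maxEntropyOne (ρ : Matrix A A ℂ) : ℝ :=
  maxEntropy (ρ.submatrix (Prod.fst : A × Unit → A) Prod.fst)

/-! ### Messages and encoders -/

/-- The vector `|φ⟩_{MR} = ∑ i, √(p i) |i⟩|i⟩`, where `R` is a copy of `M`. -/
def messageVec (p : A → ℝ) : A × A → ℂ := fun x => if x.1 = x.2 then ((√(p x.1) : ℝ) : ℂ) else 0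

/-- The isometry `|m⟩ ↦ |ι m⟩` given by an injection of basis elements. -/
def embedOp (ι : B ↪ A) : Matrix A B ℂ := Matrix.of fun a m => if a = ι m then 1 else 0

/-- The permutation operator `P(π)`, with `P(π)|i⟩ = |π i⟩`. -/
def permOp (π : Equiv.Perm A) : Matrix A A ℂ := Matrix.of fun a i => if a = π i then 1 else 0

/-- `ρ_{BR} ↦ (W ⊗ 1_R) ρ_{BR} (W ⊗ 1_R)†`. -/
def conjFirst (W : Matrix A B ℂ) (ρ : Matrix (B × C) (B × C) ℂ) : Matrix (A × C) (A × C) ℂ :=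
  (W ⊗ₖ (1 : Matrix C C ℂ)) * ρ * (W ⊗ₖ (1 : Matrix C C ℂ))ᴴ

end Definitions

end

end OneShot

open OneShot

/-! Encode `m` as the basis state `π (ι m)` with `π` a uniformly random permutation. A
classical-quantum `T` kills off-diagonal matrix units, so decoding means discriminating the states
`τ m = T |π (ι m)⟩⟨π (ι m)|` with prior `p`, and the trace norm is twice the error probability
(`traceNorm_measure_eq`).

The decoder is the pretty good measurement. Let `G` be the Gram operator of the weighted `τ m` and
`𝒞` the pinching to diagonal blocks. The error is at most the squared Hilbert-Schmidt distance of
`√G` and `√𝒞(G)`, hence by Powers-Størmer at most `tr u (G - 𝒞(G))` for some `-1 ≤ u ≤ 1`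
(`exists_measurement`).

Up to a transpose and a factor `d_A`, `G` is the complementary state `ω_AC` compressed by the
codebook (`gram_eq_smul_transpose`), so decoding becomes decoupling from `C`. Replace `ω` by an
`ε`-close `ω' ≤ 2^(-l) 1 ⊗ σ`; averaged over `π` this costs `2ε` for `u` and `2ε` for its pinching
(`re_trace_sum_code_le`). For `ω'`, a Cauchy-Schwarz estimate weighted by `σ` on `C` and by `s` on
`M`, with double transitivity of the permutations, gives `√(L c / (d_A - 1))`
(`re_trace_offdiag_sum_le`). Here `c = 2^(-l)`, and `L` bounds `∑ p m / s m`, which the max-entropy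
of the message controls (`exists_weights_of_lt_minEntropy`). Some `π` does at least as well as the
average. -/

namespace OneShot

set_option linter.unusedSectionVars false

/-! ### Matrix inequalities: polar decomposition, Powers-Størmer, Fuchs-van de Graaf, weighted
Cauchy-Schwarz. -/

section MatrixAnalysis

variable {m n : Type*} [Fintype m] [Fintype n]

theorem re_trace_mul_nonneg {P Q : Matrix n n ℂ} (hP : P.PosSemidef) (hQ : Q.PosSemidef) :
    0 ≤ (P * Q).trace.re := by
  classical
  obtain ⟨C, rfl⟩ := CStarAlgebra.nonneg_iff_eq_star_mul_self.mp hP.nonneg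
  rw [Matrix.star_eq_conjTranspose]
  rw [Matrix.mul_assoc, Matrix.trace_mul_comm]
  exact (Complex.le_def.mp (hQ.mul_mul_conjTranspose_same C).trace_nonneg).1

theorem re_trace_nonneg {P : Matrix n n ℂ} (hP : P.PosSemidef) : 0 ≤ P.trace.re :=
  (Complex.le_def.mp hP.trace_nonneg).1

theorem re_trace_mul_conjTranspose_self (X : Matrix m n ℂ) :
    (X * Xᴴ).trace.re = ∑ i, ∑ j, ‖X i j‖ ^ 2 := by
  simp only [Matrix.trace, Matrix.diag_apply, Matrix.mul_apply, Matrix.conjTranspose_apply,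
    Complex.re_sum]
  refine Finset.sum_congr rfl fun i _ => Finset.sum_congr rfl fun j _ => ?_
  rw [Complex.star_def, Complex.mul_conj, Complex.ofReal_re, Complex.normSq_eq_norm_sq]

theorem posSemidef_sqrt [DecidableEq n] (X : Matrix n n ℂ) : (CFC.sqrt X).PosSemidef :=
  Matrix.nonneg_iff_posSemidef.mp (CFC.sqrt_nonneg X)

theorem cfc_mul' [DecidableEq n] (f g : ℝ → ℝ) (X : Matrix n n ℂ) :
    cfc f X * cfc g X = cfc (fun x => f x * g x) X :=
  (cfc_mul f g X (X.finite_real_spectrum.continuousOn _) (X.finite_real_spectrum.continuousOn _)).symm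

theorem cfc_mul_self [DecidableEq n] (f : ℝ → ℝ) {X : Matrix n n ℂ} (hX : IsSelfAdjoint X) :
    cfc f X * X = cfc (fun x => f x * x) X := by
  conv_lhs => rw [← congrArg (cfc f X * ·) (cfc_id' ℝ X), cfc_mul']

theorem self_mul_cfc [DecidableEq n] (f : ℝ → ℝ) {X : Matrix n n ℂ} (hX : IsSelfAdjoint X) :
    X * cfc f X = cfc (fun x => x * f x) X := by
  conv_lhs => rw [← congrArg (· * cfc f X) (cfc_id' ℝ X), cfc_mul']

/-- Polar decomposition: `S = U √(S† S)` with a partial isometry `U`. -/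
theorem exists_polar [DecidableEq m] [DecidableEq n] (S : Matrix m n ℂ) :
    ∃ U : Matrix m n ℂ, Uᴴ * S = CFC.sqrt (Sᴴ * S) ∧ (U * Uᴴ) * (U * Uᴴ) = U * Uᴴ ∧
      (Uᴴ * U) * (Uᴴ * U) = Uᴴ * U := by
  set G := Sᴴ * S with hG
  have hGp : G.PosSemidef := Matrix.posSemidef_conjTranspose_mul_self S
  have hGsa : IsSelfAdjoint G := hGp.isHermitian
  have hspec : ∀ x ∈ spectrum ℝ G, 0 ≤ x := fun x hx => spectrum_nonneg_of_nonneg hGp.nonneg hx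
  -- As `0⁻¹ = 0`, `g` gives the pseudo-inverse of `√G`, so `S * V` is only a partial isometry when
  -- `G` is singular.
  let g : ℝ → ℝ := fun x => (√x)⁻¹
  set V := cfc g G with hV
  have hVh : Vᴴ = V := (cfc_predicate g G : IsSelfAdjoint V)
  have hVG : V * G = CFC.sqrt G := by
    rw [hV, cfc_mul_self g hGsa, CFC.sqrt_eq_real_sqrt G hGp.nonneg, cfcₙ_eq_cfc]
    refine cfc_congr fun x hx => ?_
    have := hspec x hx
    simp only [g]
    rcases this.eq_or_lt with h | h
    · simp [← h]
    · have h' : √x ≠ 0 := (Real.sqrt_pos.mpr h).ne'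
      field_simp
      exact (Real.sq_sqrt this).symm
  set χ := V * G * V with hχ
  have hχ' : χ = cfc (fun x => g x * x * g x) G := by
    rw [hχ, hV, cfc_mul_self g hGsa, cfc_mul']
  have hχV : V * χ = V := by
    rw [hχ', hV, cfc_mul']
    refine cfc_congr fun x hx => ?_
    have := hspec x hx
    simp only [g]
    rcases this.eq_or_lt with h | h
    · simp [← h]
    · have h' : √x ≠ 0 := (Real.sqrt_pos.mpr h).ne'
      field_simp
      exact (Real.sq_sqrt this).symm
  have hUU : (S * V)ᴴ * (S * V) = χ := by
    rw [Matrix.conjTranspose_mul, hVh, hχ, hG]; simp only [Matrix.mul_assoc]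
  have hU : (S * V) * ((S * V)ᴴ * (S * V)) = S * V := by
    rw [hUU, Matrix.mul_assoc, hχV]
  refine ⟨S * V, ?_, ?_, ?_⟩
  · rw [Matrix.conjTranspose_mul, hVh, Matrix.mul_assoc, ← hG, hVG]
  · rw [← Matrix.mul_assoc, Matrix.mul_assoc (S * V) _ (S * V), hU]
  · rw [Matrix.mul_assoc, hU]

/-- The Powers-Størmer inequality, in variational form. -/
theorem exists_powers_stormer [DecidableEq n] {a b : Matrix n n ℂ} (ha : a.PosSemidef)
    (hb : b.PosSemidef) :
    ∃ u : Matrix n n ℂ, (1 - u).PosSemidef ∧ (1 + u).PosSemidef ∧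
      ((a - b) * (a - b)).trace.re ≤ (u * (a * a - b * b)).trace.re := by
  set H := a - b with hH
  have hHsa : IsSelfAdjoint H := (ha.isHermitian.sub hb.isHermitian)
  have hid : cfc (fun x : ℝ => x) H = H := cfc_id' ℝ H
  let s : ℝ → ℝ := fun x => if 0 ≤ x then 1 else -1
  set u := cfc s H with hu
  have hc : ∀ f : ℝ → ℝ, ContinuousOn f (spectrum ℝ H) :=
    fun f => H.finite_real_spectrum.continuousOn _
  have hone : cfc (fun _ : ℝ => (1 : ℝ)) H = 1 := cfc_const_one ℝ H
  have huH : u * H = cfc (fun x : ℝ => |x|) H := by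
    rw [hu, cfc_mul_self s hHsa]
    refine cfc_congr fun x _ => ?_
    by_cases h : 0 ≤ x
    · simp [s, h, abs_of_nonneg]
    · simp [s, h, abs_of_neg (not_le.mp h)]
  have hHu : H * u = cfc (fun x : ℝ => |x|) H := by
    rw [hu, self_mul_cfc s hHsa]
    refine cfc_congr fun x _ => ?_
    by_cases h : 0 ≤ x
    · simp [s, h, abs_of_nonneg]
    · simp [s, h, abs_of_neg (not_le.mp h)]
  set K := cfc (fun x : ℝ => |x|) H with hK
  have hpm : (K - H).PosSemidef ∧ (K + H).PosSemidef := by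
    constructor <;> rw [← Matrix.nonneg_iff_posSemidef]
    · rw [← congrArg (K - ·) hid, hK, ← cfc_sub _ _ H (hc _) (hc _)]
      exact cfc_nonneg fun x _ => sub_nonneg.mpr (le_abs_self x)
    · rw [← congrArg (K + ·) hid, hK, ← cfc_add H _ _ (hc _) (hc _)]
      exact cfc_nonneg fun x _ => by linarith [neg_abs_le x]
  refine ⟨u, ?_, ?_, ?_⟩
  · rw [← Matrix.nonneg_iff_posSemidef, ← hone, hu, ← cfc_sub _ _ H (hc _) (hc _)]
    refine cfc_nonneg fun x _ => ?_
    simp only [s]; split_ifs <;> norm_num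
  · rw [← Matrix.nonneg_iff_posSemidef, ← hone, hu, ← cfc_add H _ _ (hc _) (hc _)]
    refine cfc_nonneg fun x _ => ?_
    simp only [s]; split_ifs <;> norm_num
  -- Here `u` is the sign of `H` and `K = |H|`. Symmetrising `a² - b²` in `H` and `a + b` turns the
  -- trace into `tr K (a + b)`, which exceeds `tr H²` by `tr (K - H) a + tr (K + H) b ≥ 0`.
  · have h1 : (u * (a * a - b * b)).trace = (K * (a + b)).trace := by
      have e : a * a - b * b = (2 : ℂ)⁻¹ • (H * (a + b) + (a + b) * H) := by
        rw [hH]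
        have : (a - b) * (a + b) + (a + b) * (a - b) = (2 : ℂ) • (a * a - b * b) := by
          rw [two_smul]; noncomm_ring
        rw [this, smul_smul]; norm_num
      rw [e, Matrix.mul_smul, Matrix.trace_smul, Matrix.mul_add, Matrix.trace_add,
        ← Matrix.mul_assoc, huH, ← Matrix.mul_assoc, Matrix.trace_mul_comm (u * (a + b)),
        ← Matrix.mul_assoc, hHu, ← two_mul, smul_eq_mul]
      ring
    have h2 := re_trace_mul_nonneg hpm.1 ha
    have h3 := re_trace_mul_nonneg hpm.2 hb
    have h4 : (K * (a + b)).trace.re - (H * H).trace.re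
        = ((K - H) * a).trace.re + ((K + H) * b).trace.re := by
      rw [← Complex.sub_re, ← Complex.add_re, ← Matrix.trace_sub, ← Matrix.trace_add]
      congr 2
      rw [hH]; noncomm_ring
    rw [h1]; linarith

/-- One of the Fuchs-van de Graaf inequalities, in variational form. -/
theorem re_trace_mul_sub_le [DecidableEq n] {ρ σ : Matrix n n ℂ} (hρ : IsState ρ)
    (hσ : IsSubState σ) {L : Matrix n n ℂ} (h1 : (1 - L).PosSemidef) (h2 : (1 + L).PosSemidef) :
    (L * (ρ - σ)).trace.re ≤ 2 * purifiedDistance ρ σ := by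
  obtain ⟨U, hU, -, hU2⟩ := exists_polar (CFC.sqrt ρ * CFC.sqrt σ)
  have hF : genFidelity ρ σ = (Uᴴ * (CFC.sqrt ρ * CFC.sqrt σ)).trace.re := by
    simp [genFidelity, fidelity, traceNorm, hU, hρ.2]
  have hF0 : 0 ≤ genFidelity ρ σ := by
    rw [hF, hU]; exact re_trace_nonneg (posSemidef_sqrt _)
  have hrr : CFC.sqrt ρ * CFC.sqrt ρ = ρ := CFC.sqrt_mul_sqrt_self ρ hρ.1.nonneg
  have hss : CFC.sqrt σ * CFC.sqrt σ = σ := CFC.sqrt_mul_sqrt_self σ hσ.1.nonneg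
  have hrh : (CFC.sqrt ρ)ᴴ = CFC.sqrt ρ := (posSemidef_sqrt ρ).isHermitian
  have hsh : (CFC.sqrt σ)ᴴ = CFC.sqrt σ := (posSemidef_sqrt σ).isHermitian
  set r := CFC.sqrt ρ
  set s := CFC.sqrt σ
  set F := genFidelity ρ σ
  set b := s * Uᴴ with hb
  set Q := 1 - Uᴴ * U with hQ
  have hQh : Qᴴ = Q := by simp [hQ]
  have hQQ : Q * Q = Q := by
    rw [hQ, sub_mul, mul_sub, mul_sub, hU2]; simp
  -- The part of `σ` outside the initial space of the partial isometry `U`; `b` carries the rest,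
  -- aligned with `r` so that `tr r b†` is the fidelity.
  set c := s * Q with hc
  have hσ' : σ = b * bᴴ + c * cᴴ := by
    rw [hb, hc, Matrix.conjTranspose_mul, Matrix.conjTranspose_mul, hQh, hsh,
      Matrix.conjTranspose_conjTranspose]
    have e1 : s * Q * (Q * s) = s * (Q * Q) * s := by simp only [Matrix.mul_assoc]
    have e2 : s * Uᴴ * (U * s) = s * (Uᴴ * U) * s := by simp only [Matrix.mul_assoc]
    rw [e1, e2, hQQ, ← add_mul, ← mul_add, hQ, add_sub_cancel, mul_one, hss]
  have hrb : (r * bᴴ).trace.re = F := by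
    have : r * bᴴ = (b * r)ᴴ := by rw [Matrix.conjTranspose_mul b, hrh]
    rw [this, Matrix.trace_conjTranspose, hF, hb, Matrix.trace_mul_comm, ← Matrix.mul_assoc,
      Matrix.trace_mul_comm (r * s)]
    simp
  have hbr : (b * rᴴ).trace.re = F := by
    rw [hrh, hF, hb, Matrix.trace_mul_comm, ← Matrix.mul_assoc, Matrix.trace_mul_comm (r * s)]
  -- Test `1 - L` on `r - β b` and `1 + L` on `β r - b`: the cross terms in `L` cancel in the sum.
  have key : ∀ β : ℝ, 0 ≤ β → β ≤ 1 → (1 - β ^ 2) * (L * (ρ - σ)).trace.re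
      ≤ (1 + β ^ 2) * (1 + σ.trace.re) - 4 * β * F := by
    intro β hβ0 hβ1
    have p1 := re_trace_mul_nonneg h1 (Matrix.posSemidef_self_mul_conjTranspose (r - (β : ℂ) • b))
    have p2 := re_trace_mul_nonneg h2 (Matrix.posSemidef_self_mul_conjTranspose ((β : ℂ) • r - b))
    have p3 := re_trace_mul_nonneg h2 (Matrix.posSemidef_self_mul_conjTranspose c)
    have p4 := re_trace_nonneg (Matrix.posSemidef_self_mul_conjTranspose c)
    have hρ' : ρ = r * rᴴ := by rw [hrh, hrr]
    have t1 : (r * rᴴ).trace.re = 1 := by rw [← hρ', hρ.2]; simp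
    have t2 : σ.trace.re = (b * bᴴ).trace.re + (c * cᴴ).trace.re := by
      nth_rewrite 1 [hσ']; simp
    have t3 : (L * (ρ - σ)).trace.re = (L * (r * rᴴ)).trace.re - (L * (b * bᴴ)).trace.re
        - (L * (c * cᴴ)).trace.re := by
      nth_rewrite 1 [hσ']; rw [hρ']; simp [mul_sub, mul_add]; ring
    rw [t3, t2]
    simp only [Matrix.conjTranspose_sub, Matrix.conjTranspose_smul, Complex.star_def,
      Complex.conj_ofReal, sub_mul, mul_sub, add_mul, Matrix.one_mul, Matrix.smul_mul,
      Matrix.mul_smul, Matrix.trace_sub, Matrix.trace_add, Matrix.trace_smul, smul_eq_mul,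
      Complex.sub_re, Complex.add_re, Complex.re_ofReal_mul, t1, hrb, hbr] at p1 p2 p3
    nlinarith [mul_nonneg (sub_nonneg.mpr (pow_le_one₀ hβ0 hβ1 : β ^ 2 ≤ 1)) p3,
      mul_nonneg (sq_nonneg β) p4]
  set z := (L * (ρ - σ)).trace.re
  set t := σ.trace.re
  have ht1 : t ≤ 1 := by simpa using (Complex.le_def.mp hσ.2).1
  have ht0 : 0 ≤ t := re_trace_nonneg hσ.1
  by_cases hz : z ≤ 0
  · exact hz.trans (by unfold purifiedDistance; positivity)
  push Not at hz
  have hFt : 2 * F ≤ 1 + t := by have := key 1 zero_le_one le_rfl; nlinarith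
  have hpos : 0 < 1 + t + z := by linarith
  have h5 : z ^ 2 ≤ (1 + t) ^ 2 - 4 * F ^ 2 := by
    -- The optimal `β`; it is at most `1` by `hFt`, which is the case `β = 1`.
    have := key (2 * F / (1 + t + z)) (by positivity) ((div_le_one hpos).mpr (by linarith))
    have e : (1 - (2 * F / (1 + t + z)) ^ 2) * z - ((1 + (2 * F / (1 + t + z)) ^ 2) * (1 + t)
        - 4 * (2 * F / (1 + t + z)) * F) = (z ^ 2 - ((1 + t) ^ 2 - 4 * F ^ 2)) / (1 + t + z) := by
      field_simp; ring
    have h6 : (z ^ 2 - ((1 + t) ^ 2 - 4 * F ^ 2)) / (1 + t + z) ≤ 0 := by rw [← e]; linarith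
    by_contra h7
    push Not at h7
    have : 0 < (z ^ 2 - ((1 + t) ^ 2 - 4 * F ^ 2)) / (1 + t + z) := div_pos (by linarith) hpos
    linarith
  have h6 : (z / 2) ≤ √(1 - F ^ 2) := Real.le_sqrt_of_sq_le (by nlinarith)
  unfold purifiedDistance
  linarith

/-- If `0 ≤ ω ≤ c κ` then `tr ω κ⁻¹ ω ≤ c tr ω`. -/
theorem re_trace_mul_inv_mul_le [DecidableEq n] {ω κ N : Matrix n n ℂ} {c : ℝ} (hc : 0 < c)
    (hω : ω.PosSemidef) (hκN : N * κ = 1) (hN : Nᴴ = N) (h : ω ≤ c • κ) :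
    (ω * N * ω).trace.re ≤ c * ω.trace.re := by
  have hωh : ωᴴ = ω := hω.isHermitian
  -- The minimiser of `(1 - Y)† ω (1 - Y) + Y† (c κ - ω) Y`. At this `Y` the nonnegative form equals
  -- `ω - c⁻¹ ω κ⁻¹ ω`.
  set Y : Matrix n n ℂ := (c⁻¹ : ℝ) • (N * ω) with hY
  have p1 := hω.conjTranspose_mul_mul_same (1 - Y)
  have p2 := (Matrix.le_iff.mp h).conjTranspose_mul_mul_same Y
  have hYh : Yᴴ = (c⁻¹ : ℝ) • (ω * N) := by
    rw [hY, Matrix.conjTranspose_smul, Matrix.conjTranspose_mul, hN, hωh]; simp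
  have hκ2 : κ * N = 1 := mul_eq_one_comm.mp hκN
  have e : (1 - Y)ᴴ * ω * (1 - Y) + Yᴴ * (c • κ - ω) * Y = ω - (c⁻¹ : ℝ) • (ω * N * ω) := by
    have e1 : Yᴴ * (c • κ) * Y = (c⁻¹ : ℝ) • (ω * N * ω) := by
      rw [hYh, hY]
      simp only [Matrix.smul_mul, Matrix.mul_smul, smul_smul]
      rw [show ω * N * κ * (N * ω) = ω * N * (κ * N) * ω by simp only [Matrix.mul_assoc], hκ2,
        mul_one]
      congr 1
      field_simp
    have e2 : ω * Y = (c⁻¹ : ℝ) • (ω * N * ω) := by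
      rw [hY, Matrix.mul_smul, Matrix.mul_assoc]
    have e3 : Yᴴ * ω = (c⁻¹ : ℝ) • (ω * N * ω) := by rw [hYh, Matrix.smul_mul]
    have e4 : (1 - Y)ᴴ * ω * (1 - Y) + Yᴴ * (c • κ - ω) * Y
        = ω - ω * Y - Yᴴ * ω + Yᴴ * (c • κ) * Y := by
      rw [Matrix.conjTranspose_sub, Matrix.conjTranspose_one]; noncomm_ring
    rw [e4, e1, e2, e3]; abel
  have p3 := re_trace_nonneg (p1.add p2)
  rw [e, Matrix.trace_sub, Matrix.trace_smul, Complex.sub_re, Complex.smul_re, smul_eq_mul] at p3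
  have : c * (c⁻¹ * (ω * N * ω).trace.re) ≤ c * ω.trace.re :=
    mul_le_mul_of_nonneg_left (by linarith) hc.le
  rwa [← mul_assoc, mul_inv_cancel₀ hc.ne', one_mul] at this

/-- Young's inequality in the `κ`-weighted Hilbert-Schmidt form: expand the square of `α X κ - ω†`
with respect to `N = κ⁻¹`. -/
theorem two_mul_re_trace_mul_le [DecidableEq n] {κ N : Matrix n n ℂ} (hN : N.PosSemidef)
    (hκ : κᴴ = κ) (hκN : N * κ = 1) (α : ℝ) (X ω : Matrix n n ℂ) :
    2 * α * (X * ω).trace.re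
      ≤ α ^ 2 * (X * κ * Xᴴ).trace.re + (ωᴴ * N * ω).trace.re := by
  have hκ2 : κ * N = 1 := mul_eq_one_comm.mp hκN
  have p := re_trace_nonneg (hN.mul_mul_conjTranspose_same ((α : ℂ) • (X * κ) - ωᴴ))
  have e : ((α : ℂ) • (X * κ) - ωᴴ) * N * ((α : ℂ) • (X * κ) - ωᴴ)ᴴ
      = (α : ℂ) • (α : ℂ) • (X * κ * Xᴴ) - (α : ℂ) • (X * ω) - (α : ℂ) • (X * ω)ᴴ + ωᴴ * N * ω := by
    simp only [Matrix.conjTranspose_sub, Matrix.conjTranspose_smul, Matrix.conjTranspose_mul, hκ,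
      Matrix.conjTranspose_conjTranspose, Complex.star_def, Complex.conj_ofReal, sub_mul, mul_sub,
      Matrix.smul_mul, Matrix.mul_smul]
    rw [show X * κ * N * (κ * Xᴴ) = X * (κ * N) * κ * Xᴴ by simp only [Matrix.mul_assoc],
      show X * κ * N * ω = X * (κ * N) * ω by simp only [Matrix.mul_assoc],
      show ωᴴ * N * (κ * Xᴴ) = ωᴴ * (N * κ) * Xᴴ by simp only [Matrix.mul_assoc], hκ2, hκN]
    simp only [mul_one]
    abel
  rw [e] at p
  simp only [Matrix.trace_sub, Matrix.trace_add, Matrix.trace_smul, smul_eq_mul, Complex.sub_re,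
    Complex.add_re, Complex.re_ofReal_mul, Matrix.trace_conjTranspose, Complex.star_def,
    Complex.conj_re] at p
  nlinarith

end MatrixAnalysis

/-! ### Averages over the symmetric group. -/

section Permutations

variable {A : Type*} [Fintype A] [DecidableEq A]

theorem sum_perm_apply (f : A → ℝ) (a : A) :
    (Fintype.card A : ℝ) * ∑ π : Equiv.Perm A, f (π a)
      = Fintype.card (Equiv.Perm A) * ∑ i, f i := by
  have h : ∀ b, ∑ π : Equiv.Perm A, f (π b) = ∑ π : Equiv.Perm A, f (π a) := fun b =>
    Fintype.sum_equiv (Equiv.mulRight (Equiv.swap a b)) _ _ fun π => by simp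
  calc (Fintype.card A : ℝ) * ∑ π : Equiv.Perm A, f (π a)
      = ∑ b, ∑ π : Equiv.Perm A, f (π b) := by simp [h]
    _ = ∑ π : Equiv.Perm A, ∑ b, f (π b) := Finset.sum_comm
    _ = ∑ π : Equiv.Perm A, ∑ b, f b := by
        refine Finset.sum_congr rfl fun π _ => Equiv.sum_comp π f
    _ = _ := by simp

theorem exists_perm_apply_eq {a b a' b' : A} (h : a ≠ b) (h' : a' ≠ b') :
    ∃ τ : Equiv.Perm A, τ a = a' ∧ τ b = b' := by
  refine ⟨Equiv.swap (Equiv.swap a a' b) b' * Equiv.swap a a', ?_, by simp⟩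
  rw [Equiv.Perm.mul_apply, Equiv.swap_apply_left]
  refine Equiv.swap_apply_of_ne_of_ne ?_ h'
  intro hc
  apply h
  apply (Equiv.swap a a').injective
  rw [← hc, Equiv.swap_apply_left]

/-- Double transitivity makes the sum independent of the pair `a ≠ b`, so it may be averaged over
all `d (d - 1)` such pairs. This is the source of the factor `1 / (d_A - 1)`. -/
theorem sum_perm_apply_apply (f : A → A → ℝ) {a b : A} (hab : a ≠ b) :
    (Fintype.card A : ℝ) * (Fintype.card A - 1) * ∑ π : Equiv.Perm A, f (π a) (π b)
      = Fintype.card (Equiv.Perm A) * ∑ i, ∑ j, if i ≠ j then f i j else 0 := by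
  have h : ∀ i j, i ≠ j → ∑ π : Equiv.Perm A, f (π i) (π j)
      = ∑ π : Equiv.Perm A, f (π a) (π b) := fun i j hij => by
    obtain ⟨τ, rfl, rfl⟩ := exists_perm_apply_eq hab hij
    exact Fintype.sum_equiv (Equiv.mulRight τ) _ _ fun π => by simp
  have hcard : ∀ c : ℝ, ∑ i : A, ∑ j : A, (if i ≠ j then c else 0)
      = (Fintype.card A : ℝ) * (Fintype.card A - 1) * c := fun c => by
    have : ∀ i : A, ∑ j : A, (if i ≠ j then c else 0) = (Fintype.card A - 1) * c := fun i => by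
      have e : ∀ j : A, (if i ≠ j then c else 0) = c - if i = j then c else 0 := fun j => by
        by_cases hij : i = j <;> simp [hij]
      simp only [e, Finset.sum_sub_distrib, Finset.sum_ite_eq, Finset.mem_univ, if_true]
      simp; ring
    simp only [this]
    simp; ring
  rw [← hcard]
  calc ∑ i : A, ∑ j : A, (if i ≠ j then ∑ π : Equiv.Perm A, f (π a) (π b) else 0)
      = ∑ i : A, ∑ j : A, ∑ π : Equiv.Perm A, (if π i ≠ π j then f (π i) (π j) else 0) := by
        refine Finset.sum_congr rfl fun i _ => Finset.sum_congr rfl fun j _ => ?_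
        by_cases hij : i = j
        · simp [hij]
        · simp [hij, h i j hij]
    _ = ∑ π : Equiv.Perm A, ∑ i : A, ∑ j : A, (if π i ≠ π j then f (π i) (π j) else 0) := by
        rw [Finset.sum_comm' (t' := Finset.univ) (s' := fun _ => Finset.univ) (by simp)]
        simp only [Finset.sum_comm (s := (Finset.univ : Finset A))
          (t := (Finset.univ : Finset (Equiv.Perm A)))]
        exact Finset.sum_congr rfl fun π _ => Finset.sum_comm
    _ = ∑ π : Equiv.Perm A, ∑ i : A, ∑ j : A, (if i ≠ j then f i j else 0) := by
        refine Finset.sum_congr rfl fun π _ => ?_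
        rw [← Equiv.sum_comp π (fun i => ∑ j, if i ≠ j then f i j else 0)]
        refine Finset.sum_congr rfl fun i _ => ?_
        rw [← Equiv.sum_comp π (fun j => if π i ≠ j then f (π i) j else 0)]
    _ = _ := by simp

end Permutations

/-! ### Pinching, the random codebook map, and the cost of smoothing. -/

section Decoupling

variable {A B M : Type*} [Fintype A] [DecidableEq A] [Fintype B] [DecidableEq B]
  [Fintype M] [DecidableEq M]

theorem classicalize_posSemidef {X : Matrix (M × B) (M × B) ℂ} (hX : X.PosSemidef) :
    (classicalize X).PosSemidef := by
  have e : classicalize X = ∑ a : M,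
      (Matrix.diagonal fun x : M × B => if x.1 = a then (1 : ℂ) else 0) * X *
        (Matrix.diagonal fun x : M × B => if x.1 = a then (1 : ℂ) else 0)ᴴ := by
    ext x y
    simp only [classicalize, Matrix.of_apply, Matrix.sum_apply, Matrix.diagonal_conjTranspose,
      Matrix.mul_diagonal, Matrix.diagonal_mul]
    rw [Finset.sum_eq_single x.1]
    · by_cases h : x.1 = y.1 <;> simp [h, eq_comm]
    · intro b _ hb; simp [hb.symm]
    · simp
  rw [e]
  exact Matrix.posSemidef_sum _ fun a _ => hX.mul_mul_conjTranspose_same _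

theorem classicalize_one : classicalize (1 : Matrix (M × B) (M × B) ℂ) = 1 := by
  ext x y
  by_cases h : x = y
  · subst h; simp [classicalize]
  · simp [classicalize, h]

theorem classicalize_add (X Y : Matrix (M × B) (M × B) ℂ) :
    classicalize (X + Y) = classicalize X + classicalize Y := by
  ext x y
  by_cases h : x.1 = y.1 <;> simp [classicalize, h]

theorem classicalize_sub (X Y : Matrix (M × B) (M × B) ℂ) :
    classicalize (X - Y) = classicalize X - classicalize Y := by
  ext x y
  by_cases h : x.1 = y.1 <;> simp [classicalize, h]

/-- The `B`-blocks of an operator on `MB`. -/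
def block (X : Matrix (M × B) (M × B) ℂ) (m m' : M) : Matrix B B ℂ :=
  X.submatrix (Prod.mk m) (Prod.mk m')

/-- The duplication of the first index. -/
def copyFst (x : A × B) : A × (A × B) := (x.1, x)

/-- The codebook map `∑ m, √(p m) |m⟩⟨c m, c m|`, tensored with the identity. -/
noncomputable def codeOp (B : Type*) [DecidableEq B] (p : M → ℝ) (c : M → A) : Matrix (M × B) (A × (A × B)) ℂ :=
  Matrix.of fun x y => if copyFst (c x.1, x.2) = y then ((√(p x.1) : ℝ) : ℂ) else 0

theorem codeOp_mul_mul_apply (p : M → ℝ) (c : M → A)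
    (X : Matrix (A × (A × B)) (A × (A × B)) ℂ) (x y : M × B) :
    (codeOp B p c * X * (codeOp B p c)ᴴ) x y = (√(p x.1) : ℝ) * (√(p y.1) : ℝ) *
      X (copyFst (c x.1, x.2)) (copyFst (c y.1, y.2)) := by
  simp only [Matrix.mul_apply, codeOp, Matrix.of_apply, Matrix.conjTranspose_apply, ite_mul,
    zero_mul, Finset.sum_ite_eq, Finset.mem_univ, if_true, apply_ite star, star_zero,
    mul_ite, mul_zero, Complex.star_def, Complex.conj_ofReal]
  ring

theorem codeOp_conjTranspose_mul_self {p : M → ℝ} (hp : ∀ m, 0 ≤ p m) (c : M → A) :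
    (codeOp B p c)ᴴ * (codeOp B p c) = Matrix.diagonal fun y : A × (A × B) =>
      ((∑ m, if c m = y.1 ∧ c m = y.2.1 then p m else 0 : ℝ) : ℂ) := by
  ext y z
  simp only [Matrix.mul_apply, codeOp, Matrix.of_apply, Matrix.conjTranspose_apply,
    apply_ite star, star_zero, Complex.star_def, Complex.conj_ofReal, mul_ite, mul_zero, ite_mul,
    zero_mul, Matrix.diagonal_apply, Complex.ofReal_sum, Fintype.sum_prod_type]
  by_cases hyz : y = z
  · subst hyz
    simp only [if_true]
    refine Finset.sum_congr rfl fun m _ => ?_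
    rw [Finset.sum_eq_single y.2.2]
    · by_cases h : c m = y.1 ∧ c m = y.2.1
      · have : copyFst (c m, y.2.2) = y := by
          ext <;> simp [copyFst, h.1]
          rw [← h.1, h.2]
        rw [if_pos this, if_pos this, if_pos h, ← Complex.ofReal_mul, Real.mul_self_sqrt (hp m)]
      · have : copyFst (c m, y.2.2) ≠ y := by
          rintro h'
          apply h
          rw [← h']; simp [copyFst]
        simp [this, h]
    · intro b _ hb
      have : copyFst (c m, b) ≠ y := by
        rintro rfl; simp [copyFst] at hb
      simp [this]
    · simp
  · rw [if_neg hyz]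
    refine Finset.sum_eq_zero fun m _ => Finset.sum_eq_zero fun b _ => ?_
    by_cases h : copyFst (c m, b) = y
    · have : copyFst (c m, b) ≠ z := fun h' => hyz (h.symm.trans h')
      simp [this]
    · simp [h]

theorem conjTranspose_eq_of_posSemidef_one_sub {n : Type*} [Fintype n] [DecidableEq n]
    {v : Matrix n n ℂ} (h : (1 - v).PosSemidef) : vᴴ = v := by
  have := h.isHermitian.eq
  rw [Matrix.conjTranspose_sub, Matrix.conjTranspose_one] at this
  exact sub_right_injective this

/-- As `v` is Hermitian and `1 ± v` commute, `2 (1 - v²) = (1 - v)(1 + v)(1 - v) + (1 + v)(1 - v)(1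
+ v)`. -/
theorem posSemidef_one_sub_conjTranspose_mul_self {n : Type*} [Fintype n] [DecidableEq n]
    {v : Matrix n n ℂ} (h1 : (1 - v).PosSemidef) (h2 : (1 + v).PosSemidef) :
    (1 - vᴴ * v).PosSemidef := by
  have e : 1 - vᴴ * v = (2⁻¹ : ℝ) • ((1 - v) * (1 + v) * (1 - v)ᴴ + (1 + v) * (1 - v) * (1 + v)ᴴ) := by
    rw [h1.isHermitian.eq, h2.isHermitian.eq, conjTranspose_eq_of_posSemidef_one_sub h1]
    have : (1 - v) * (1 + v) * (1 - v) + (1 + v) * (1 - v) * (1 + v) = (2 : ℝ) • (1 - v * v) := by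
      rw [two_smul]; noncomm_ring
    rw [this, smul_smul]; norm_num
  rw [e]
  exact ((h2.mul_mul_conjTranspose_same _).add (h1.mul_mul_conjTranspose_same _)).smul
    (by norm_num)

/-- Moving the codebook maps onto `v` turns the average into a single test operator on `A × (A ×
B)`, still between `-1` and `1`. Hence `re_trace_mul_sub_le` applies once, with no loss in `d_A`. -/
theorem re_trace_sum_code_le {p : M → ℝ} (hp : ∀ m, 0 ≤ p m) (hp1 : ∑ m, p m = 1) (ι : M ↪ A)
    {ρ σ : Matrix (A × (A × B)) (A × (A × B)) ℂ} (hρ : IsState ρ) (hσ : IsSubState σ)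
    {v : Equiv.Perm A → Matrix (M × B) (M × B) ℂ} (h1 : ∀ π, (1 - v π).PosSemidef)
    (h2 : ∀ π, (1 + v π).PosSemidef) :
    (Fintype.card A : ℝ) * ∑ π : Equiv.Perm A, (v π * (codeOp B p (fun m => π (ι m)) * (ρ - σ) *
      (codeOp B p (fun m => π (ι m)))ᴴ)).trace.re
      ≤ (Fintype.card (Equiv.Perm A) : ℝ) * (2 * purifiedDistance ρ σ) := by
  set N : ℝ := ((Fintype.card (Equiv.Perm A) : ℕ) : ℝ) with hN
  have hN0 : 0 < N := by rw [hN]; exact_mod_cast Fintype.card_pos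
  set d : ℝ := ((Fintype.card A : ℕ) : ℝ) with hd
  set W : Equiv.Perm A → Matrix (M × B) (A × (A × B)) ℂ := fun π => codeOp B p fun m => π (ι m)
    with hW
  have hd0 : 0 ≤ d := by rw [hd]; positivity
  -- Each `π (ι m)` is uniform on `A`, so `d` times the average of `W† W` is the projection onto the
  -- range of `copyFst`.
  have hsum : (1 - (d / N : ℝ) • ∑ π, (W π)ᴴ * W π).PosSemidef := by
    have e : 1 - (d / N : ℝ) • ∑ π, (W π)ᴴ * W π = Matrix.diagonal fun y : A × (A × B) =>
        (((1 : ℝ) - (if y.1 = y.2.1 then 1 else 0) : ℝ) : ℂ) := by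
      have e0 : ∀ π, (W π)ᴴ * W π = Matrix.diagonal fun y : A × (A × B) =>
        ((∑ m, if π (ι m) = y.1 ∧ π (ι m) = y.2.1 then p m else 0 : ℝ) : ℂ) := fun π =>
          codeOp_conjTranspose_mul_self hp _
      ext y z
      simp only [e0, Matrix.sub_apply, Matrix.smul_apply, Matrix.sum_apply, Matrix.diagonal_apply,
        Matrix.one_apply]
      by_cases hyz : y = z
      · subst hyz
        simp only [if_true]
        rw [← Complex.ofReal_sum, Complex.real_smul, ← Complex.ofReal_mul, ← Complex.ofReal_one,
          ← Complex.ofReal_sub]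
        congr 2
        rw [Finset.sum_comm]
        have : ∀ m, d * ∑ π : Equiv.Perm A, (if π (ι m) = y.1 ∧ π (ι m) = y.2.1 then p m else 0)
            = N * ((if y.1 = y.2.1 then 1 else 0) * p m) := fun m => by
          rw [hd, sum_perm_apply (fun a => if a = y.1 ∧ a = y.2.1 then p m else 0) (ι m)]
          congr 1
          rw [Finset.sum_eq_single y.1]
          · by_cases h : y.1 = y.2.1 <;> simp [h]
          · intro b _ hb; simp [hb]
          · simp
        rw [div_mul_eq_mul_div, Finset.mul_sum]
        simp only [this]
        rw [← Finset.mul_sum, ← Finset.mul_sum, hp1]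
        field_simp
      · simp [hyz]
    rw [e]
    refine Matrix.PosSemidef.diagonal fun y => ?_
    by_cases h : y.1 = y.2.1 <;> simp [h]
  have hbd : ∀ w : Equiv.Perm A → Matrix (M × B) (M × B) ℂ, (∀ π, (1 - w π).PosSemidef) →
      (1 - (d / N : ℝ) • ∑ π, (W π)ᴴ * w π * W π).PosSemidef := fun w hw => by
    have e : 1 - (d / N : ℝ) • ∑ π, (W π)ᴴ * w π * W π = (1 - (d / N : ℝ) • ∑ π, (W π)ᴴ * W π)
        + (d / N : ℝ) • ∑ π, (W π)ᴴ * (1 - w π) * W π := by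
      simp only [Finset.sum_sub_distrib, Matrix.mul_sub,
        Matrix.sub_mul, Matrix.mul_one, smul_sub]
      abel
    rw [e]
    exact hsum.add ((Matrix.posSemidef_sum _ fun π _ =>
      (hw π).conjTranspose_mul_mul_same _).smul (by positivity))
  have hneg : (1 + (d / N : ℝ) • ∑ π, (W π)ᴴ * v π * W π).PosSemidef := by
    have := hbd (fun π => -v π) (fun π => by rw [sub_neg_eq_add]; exact h2 π)
    simpa only [Matrix.mul_neg, Matrix.neg_mul, Finset.sum_neg_distrib, smul_neg,
      sub_neg_eq_add] using this
  have key := re_trace_mul_sub_le hρ hσ (hbd v h1) hneg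
  rw [Matrix.smul_mul, Matrix.trace_smul, Complex.smul_re, smul_eq_mul, Matrix.sum_mul,
    Matrix.trace_sum, Complex.re_sum] at key
  have e : ∀ π, ((W π)ᴴ * v π * W π * (ρ - σ)).trace = (v π * (W π * (ρ - σ) * (W π)ᴴ)).trace :=
    fun π => by
      rw [show (W π)ᴴ * v π * W π * (ρ - σ) = (W π)ᴴ * (v π * (W π * (ρ - σ))) by
        simp only [Matrix.mul_assoc], Matrix.trace_mul_comm]
      simp only [Matrix.mul_assoc]
  simp only [e] at key
  rw [div_mul_eq_mul_div, div_le_iff₀ hN0] at key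
  linarith

end Decoupling

/-! ### Second-moment bound for the off-diagonal blocks. -/

section SecondMoment

variable {A B M : Type*} [Fintype A] [DecidableEq A] [Fintype B] [DecidableEq B]
  [Fintype M] [DecidableEq M]

theorem trace_mul_eq_sum_block (X Z : Matrix (M × B) (M × B) ℂ) :
    (X * Z).trace = ∑ m', ∑ m, (block X m' m * block Z m m').trace := by
  simp only [Matrix.trace, Matrix.diag_apply, Matrix.mul_apply, Fintype.sum_prod_type, block,
    Matrix.submatrix_apply]
  exact Finset.sum_congr rfl fun m' _ => Finset.sum_comm

theorem trace_eq_sum_block (X : Matrix (M × B) (M × B) ℂ) :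
    X.trace = ∑ m, (block X m m).trace := by
  simp only [Matrix.trace, Matrix.diag_apply, Fintype.sum_prod_type, block,
    Matrix.submatrix_apply]

theorem block_mul (X Z : Matrix (M × B) (M × B) ℂ) (i j : M) :
    block (X * Z) i j = ∑ k, block X i k * block Z k j := by
  ext b b'
  simp only [block, Matrix.submatrix_apply, Matrix.mul_apply, Fintype.sum_prod_type,
    Matrix.sum_apply]

theorem block_classicalize (X : Matrix (M × B) (M × B) ℂ) (i j : M) :
    block (classicalize X) i j = if i = j then block X i j else 0 := by
  ext b b'
  by_cases h : i = j <;> simp [block, classicalize, h]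

theorem block_conjTranspose (X : Matrix (M × B) (M × B) ℂ) (i j : M) :
    block Xᴴ i j = (block X j i)ᴴ := rfl

theorem block_sub (X Y : Matrix (M × B) (M × B) ℂ) (i j : M) :
    block (X - Y) i j = block X i j - block Y i j := rfl

/-- The `(m, m)` block of `v† v ≤ 1` says that the blocks `X` in column `m` satisfy `∑ X† X ≤ 1`. -/
theorem re_trace_block_column_le {v : Matrix (M × B) (M × B) ℂ} (h1 : (1 - v).PosSemidef)
    (h2 : (1 + v).PosSemidef) {κ : Matrix B B ℂ} (hκ : κ.PosSemidef) (m : M) :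
    ∑ m', (block v m' m * κ * (block v m' m)ᴴ).trace.re ≤ κ.trace.re := by
  have h : (1 - ∑ m', (block v m' m)ᴴ * block v m' m).PosSemidef := by
    have := (posSemidef_one_sub_conjTranspose_mul_self h1 h2).submatrix (Prod.mk m)
    change (block (1 - vᴴ * v) m m).PosSemidef at this
    rw [block_sub, block_mul] at this
    have e : block (1 : Matrix (M × B) (M × B) ℂ) m m = 1 := by
      ext b b'
      simp [block, Matrix.one_apply]
    rw [e] at this
    exact this
  have := re_trace_mul_nonneg hκ h
  rw [mul_sub, mul_one, Matrix.mul_sum, Matrix.trace_sub, Matrix.trace_sum, Complex.sub_re,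
    Complex.re_sum] at this
  have e : ∀ m', (block v m' m * κ * (block v m' m)ᴴ).trace
      = (κ * ((block v m' m)ᴴ * block v m' m)).trace := fun m' => by
    rw [Matrix.mul_assoc, Matrix.trace_mul_comm, Matrix.mul_assoc]
  simp only [e]
  linarith

/-- On the copied basis the min-entropy bound `ω ≤ c (1 ⊗ σ)` becomes a bound by a block-diagonal
operator, which can be inverted block by block. -/
theorem submatrix_copyFst_kronecker (σ : Matrix (A × B) (A × B) ℂ) :
    ((1 : Matrix A A ℂ) ⊗ₖ σ).submatrix copyFst copyFst = classicalize σ := by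
  ext x y
  by_cases h : x.1 = y.1 <;> simp [classicalize, copyFst, h]

theorem re_trace_submatrix_copyFst_le {ω : Matrix (A × (A × B)) (A × (A × B)) ℂ}
    (hω : ω.PosSemidef) : (ω.submatrix copyFst copyFst).trace.re ≤ ω.trace.re := by
  simp only [Matrix.trace, Matrix.diag_apply, Matrix.submatrix_apply, Complex.re_sum, copyFst,
    Fintype.sum_prod_type]
  have h0 : ∀ x, 0 ≤ (ω x x).re := fun x => (Complex.le_def.mp (hω.diag_nonneg (i := x))).1
  refine Finset.sum_le_sum fun a _ => ?_
  exact Finset.single_le_sum (f := fun a' => ∑ b, (ω (a, (a', b)) (a, (a', b))).re)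
    (fun a' _ => Finset.sum_nonneg fun b _ => h0 _) (Finset.mem_univ a)

/-- If `0 ≤ ω ≤ c (⊕ κ i)`, then the blocks of `ω`, weighted by the `κ i`, are small. -/
theorem sum_re_trace_block_inv_le {ω σ : Matrix (A × B) (A × B) ℂ} (hω : ω.PosSemidef)
    (hσ : σ.PosDef) {c : ℝ} (hc : 0 < c) (h : ω ≤ c • classicalize σ) :
    ∑ i, ∑ j, ((block ω i j)ᴴ * (block σ i i)⁻¹ * block ω i j).trace.re ≤ c * ω.trace.re := by
  have hpd : ∀ i, (block σ i i).PosDef := fun i => hσ.submatrix (Prod.mk_right_injective i)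
  set N : Matrix (A × B) (A × B) ℂ :=
    Matrix.of fun x y => if x.1 = y.1 then (block σ x.1 x.1)⁻¹ x.2 y.2 else 0 with hN
  have hNb : ∀ i j, block N i j = if i = j then (block σ i i)⁻¹ else 0 := fun i j => by
    ext b b'
    by_cases h : i = j <;> simp [block, hN, h]
  have hNh : Nᴴ = N := by
    ext x y
    by_cases h : x.1 = y.1
    · have := (hpd y.1).inv.isHermitian.apply x.2 y.2
      simpa [hN, Matrix.conjTranspose_apply, h] using this
    · have h' : ¬ y.1 = x.1 := fun h' => h h'.symm
      simp [hN, Matrix.conjTranspose_apply, h, h']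
  have hNσ : N * classicalize σ = 1 := by
    have hb : ∀ i j, block (N * classicalize σ) i j = block 1 i j := fun i j => by
      rw [block_mul, Finset.sum_eq_single i]
      · rw [hNb, block_classicalize]
        by_cases h : i = j
        · subst h
          simp only [if_true]
          rw [Matrix.nonsing_inv_mul _ ((Matrix.isUnit_iff_isUnit_det _).mp (hpd i).isUnit)]
          ext b b'; simp [block, Matrix.one_apply]
        · rw [if_neg h, mul_zero]
          ext b b'; simp [block, h]
      · intro k _ hk; rw [hNb, if_neg hk.symm, zero_mul]
      · simp
    ext x y
    exact congrFun (congrFun (hb x.1 y.1) x.2) y.2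
  have key := re_trace_mul_inv_mul_le hc hω hNσ hNh h
  refine le_trans (le_of_eq ?_) key
  rw [Matrix.mul_assoc, trace_mul_eq_sum_block, Complex.re_sum, Finset.sum_comm]
  refine Finset.sum_congr rfl fun j _ => ?_
  rw [Complex.re_sum]
  refine Finset.sum_congr rfl fun i _ => ?_
  rw [block_mul, Finset.sum_eq_single i]
  · rw [hNb, if_pos rfl, ← Matrix.mul_assoc, ← block_conjTranspose, hω.isHermitian.eq]
  · intro k _ hk; rw [hNb, if_neg hk.symm, zero_mul]
  · simp

/-- Young's inequality for each pair `m ≠ m'` separates the test operator from the state. The first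
part sums over a column of `v` and needs only transitivity; the second is averaged over pairs. -/
theorem re_trace_offdiag_sum_le {p s : M → ℝ} (hp : ∀ m, 0 ≤ p m) (hp1 : ∑ m, p m = 1)
    (hs : ∀ m, 0 ≤ s m) (hs1 : ∑ m, s m = 1) (hps : ∀ m, s m = 0 → p m = 0)
    {L : ℝ} (hL0 : 0 < L) (hL : ∑ m, p m / s m ≤ L) (ι : M ↪ A) (hA : 2 ≤ Fintype.card A)
    {ω : Matrix (A × (A × B)) (A × (A × B)) ℂ} (hω : IsSubState ω)
    {σ : Matrix (A × B) (A × B) ℂ} (hσ : σ.PosDef) (hσ1 : σ.trace = 1) {c : ℝ} (hc : 0 < c)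
    (h : ω ≤ c • ((1 : Matrix A A ℂ) ⊗ₖ σ))
    {v : Equiv.Perm A → Matrix (M × B) (M × B) ℂ} (h1 : ∀ π, (1 - v π).PosSemidef)
    (h2 : ∀ π, (1 + v π).PosSemidef) :
    (Fintype.card A : ℝ) * ∑ π : Equiv.Perm A, ((v π - classicalize (v π)) *
      (codeOp B p (fun m => π (ι m)) * ω * (codeOp B p (fun m => π (ι m)))ᴴ)).trace.re
      ≤ (Fintype.card (Equiv.Perm A) : ℝ) * √(L * c / (Fintype.card A - 1)) := by
  set N : ℝ := ((Fintype.card (Equiv.Perm A) : ℕ) : ℝ) with hN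
  set d : ℝ := ((Fintype.card A : ℕ) : ℝ) with hd
  have hd2 : 2 ≤ d := by rw [hd]; exact_mod_cast hA
  have hN0 : 0 ≤ N := by rw [hN]; positivity
  -- The two parts contribute `t` and at most `L c / (t (d - 1))`; this `t` makes these equal.
  set t := √(L * c / (d - 1)) with ht
  have htp : 0 < t := Real.sqrt_pos.mpr (div_pos (mul_pos hL0 hc) (by linarith))
  have htt : t * t = L * c / (d - 1) :=
    Real.mul_self_sqrt (div_nonneg (mul_pos hL0 hc).le (by linarith))
  set Ω := ω.submatrix copyFst copyFst with hΩ
  have hΩp : Ω.PosSemidef := hω.1.submatrix _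
  have hΩt : Ω.trace.re ≤ 1 :=
    (re_trace_submatrix_copyFst_le hω.1).trans (by simpa using (Complex.le_def.mp hω.2).1)
  have hΩσ : Ω ≤ c • classicalize σ := by
    rw [Matrix.le_iff, ← submatrix_copyFst_kronecker]
    exact (Matrix.le_iff.mp h).submatrix _
  have hpd : ∀ i, (block σ i i).PosDef := fun i => hσ.submatrix (Prod.mk_right_injective i)
  set g : A → A → ℝ := fun i j => ((block Ω i j)ᴴ * (block σ i i)⁻¹ * block Ω i j).trace.re with hg
  have hg0 : ∀ i j, 0 ≤ g i j := fun i j =>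
    re_trace_nonneg ((hpd i).inv.posSemidef.conjTranspose_mul_mul_same _)
  have hgs : ∑ i, ∑ j, g i j ≤ c :=
    (sum_re_trace_block_inv_le hΩp hσ hc hΩσ).trans (by nlinarith)
  set k : A → ℝ := fun i => (block σ i i).trace.re with hk
  have hks : ∑ i, k i = 1 := by
    rw [hk, ← Complex.re_sum, ← trace_eq_sum_block, hσ1, Complex.one_re]
  have hterm : ∀ (π : Equiv.Perm A) (m m' : M),
      2 * (√(p m) * √(p m') * (block (v π) m' m * block Ω (π (ι m)) (π (ι m'))).trace.re)
      ≤ t * s m * (block (v π) m' m * block σ (π (ι m)) (π (ι m)) * (block (v π) m' m)ᴴ).trace.re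
        + p m * p m' / (t * s m) * g (π (ι m)) (π (ι m')) := by
    intro π m m'
    set X := block (v π) m' m
    set i := π (ι m)
    set j := π (ι m')
    have ha : 0 ≤ (X * block σ i i * Xᴴ).trace.re :=
      re_trace_nonneg ((hpd i).posSemidef.mul_mul_conjTranspose_same _)
    have hr : 0 ≤ p m * p m' / (t * s m) * g i j :=
      mul_nonneg (div_nonneg (mul_nonneg (hp _) (hp _)) (mul_nonneg htp.le (hs m))) (hg0 i j)
    have hl : 0 ≤ t * s m * (X * block σ i i * Xᴴ).trace.re :=
      mul_nonneg (mul_nonneg htp.le (hs m)) ha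
    -- This also covers `s m = 0`, which forces `p m = 0`; division by zero then reads as `0`.
    by_cases hq : √(p m) * √(p m') = 0
    · rw [hq, zero_mul, mul_zero]; positivity
    · have hqp : 0 < √(p m) * √(p m') := lt_of_le_of_ne (by positivity) (Ne.symm hq)
      have hqq : (√(p m) * √(p m')) ^ 2 = p m * p m' := by
        rw [mul_pow, Real.sq_sqrt (hp m), Real.sq_sqrt (hp m')]
      have hsm : 0 < s m := by
        refine lt_of_le_of_ne (hs m) fun h0 => hq ?_
        rw [hps m h0.symm]; simp
      have key := two_mul_re_trace_mul_le (hpd i).inv.posSemidef (hpd i).isHermitian.eq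
        (Matrix.nonsing_inv_mul _ ((Matrix.isUnit_iff_isUnit_det _).mp (hpd i).isUnit)) (t * s m / (√(p m) * √(p m'))) X
        (block Ω i j)
      rw [← hqq]
      set q := √(p m) * √(p m')
      have hts : 0 < t * s m := mul_pos htp hsm
      set z := t * s m
      set R := (X * block Ω i j).trace.re
      set a := (X * block σ i i * Xᴴ).trace.re
      change 2 * (z / q) * R ≤ (z / q) ^ 2 * a + g i j at key
      have := mul_le_mul_of_nonneg_left key (by positivity : 0 ≤ q ^ 2 / z)
      have e1 : q ^ 2 / z * (2 * (z / q) * R) = 2 * (q * R) := by field_simp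
      have e2 : q ^ 2 / z * ((z / q) ^ 2 * a + g i j) = z * a + q ^ 2 / z * g i j := by
        field_simp
      rwa [e1, e2] at this
  have htrace : ∀ π : Equiv.Perm A, ((v π - classicalize (v π)) *
      (codeOp B p (fun m => π (ι m)) * ω * (codeOp B p (fun m => π (ι m)))ᴴ)).trace.re
      = ∑ m, ∑ m', if m ≠ m' then √(p m) * √(p m') *
        (block (v π) m' m * block Ω (π (ι m)) (π (ι m'))).trace.re else 0 := by
    intro π
    rw [trace_mul_eq_sum_block, Finset.sum_comm, Complex.re_sum]
    refine Finset.sum_congr rfl fun m _ => ?_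
    rw [Complex.re_sum]
    refine Finset.sum_congr rfl fun m' _ => ?_
    have e : block (codeOp B p (fun m => π (ι m)) * ω * (codeOp B p (fun m => π (ι m)))ᴴ) m m'
        = ((√(p m) * √(p m') : ℝ) : ℂ) • block Ω (π (ι m)) (π (ι m')) := by
      ext b b'
      simp [block, codeOp_mul_mul_apply, hΩ]
    rw [e, block_sub, block_classicalize]
    by_cases hm : m = m'
    · simp [hm]
    · rw [if_pos hm, if_neg (Ne.symm hm), sub_zero, Matrix.mul_smul, Matrix.trace_smul,
        smul_eq_mul, Complex.re_ofReal_mul]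
  have hle : ∀ π : Equiv.Perm A, 2 * ((v π - classicalize (v π)) *
      (codeOp B p (fun m => π (ι m)) * ω * (codeOp B p (fun m => π (ι m)))ᴴ)).trace.re
      ≤ ∑ m, t * s m * k (π (ι m))
        + ∑ m, ∑ m', p m * p m' / (t * s m) * (if m ≠ m' then g (π (ι m)) (π (ι m')) else 0) := by
    intro π
    rw [htrace, Finset.mul_sum, ← Finset.sum_add_distrib]
    refine Finset.sum_le_sum fun m _ => ?_
    have hc1 := mul_le_mul_of_nonneg_left
      (re_trace_block_column_le (h1 π) (h2 π) (hpd (π (ι m))).posSemidef m)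
      (mul_nonneg htp.le (hs m))
    refine le_trans ?_ (add_le_add_left hc1 _)
    rw [Finset.mul_sum, Finset.mul_sum, ← Finset.sum_add_distrib]
    refine Finset.sum_le_sum fun m' _ => ?_
    by_cases hm : m = m'
    · rw [if_neg (by simpa using hm), if_neg (by simpa using hm), mul_zero, mul_zero, add_zero]
      exact mul_nonneg (mul_nonneg htp.le (hs m)) (re_trace_nonneg
        ((hpd _).posSemidef.mul_mul_conjTranspose_same _))
    · rw [if_pos hm, if_pos hm]
      exact hterm π m m'
  have hfirst : d * ∑ π : Equiv.Perm A, ∑ m, t * s m * k (π (ι m)) = N * t := by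
    rw [Finset.sum_comm, Finset.mul_sum]
    have : ∀ m, d * ∑ π : Equiv.Perm A, t * s m * k (π (ι m)) = s m * (N * t) := fun m => by
      rw [← Finset.mul_sum, mul_left_comm, sum_perm_apply k, hks]; ring
    simp only [this]
    rw [← Finset.sum_mul, hs1, one_mul]
  have hsecond : d * ∑ π : Equiv.Perm A, ∑ m, ∑ m', p m * p m' / (t * s m) *
      (if m ≠ m' then g (π (ι m)) (π (ι m')) else 0) ≤ N * t := by
    have hpair : ∀ m m', d * ∑ π : Equiv.Perm A, p m * p m' / (t * s m) *
        (if m ≠ m' then g (π (ι m)) (π (ι m')) else 0)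
        ≤ p m / s m * p m' * (N * c / (t * (d - 1))) := by
      intro m m'
      have hr : 0 ≤ p m * p m' / (t * s m) :=
        div_nonneg (mul_nonneg (hp _) (hp _)) (mul_nonneg htp.le (hs m))
      have hd1 : 0 < d - 1 := by linarith
      have hb : d * ∑ π : Equiv.Perm A, (if m ≠ m' then g (π (ι m)) (π (ι m')) else 0)
          ≤ N * c / (d - 1) := by
        by_cases hm : m = m'
        · simp only [hm, ne_eq, not_true, if_false, Finset.sum_const_zero, mul_zero]; positivity
        · simp only [ne_eq, hm, not_false_eq_true, if_true]
          rw [le_div_iff₀ hd1]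
          have := sum_perm_apply_apply g (ι.injective.ne hm)
          have h3 : ∑ i, ∑ j, (if i ≠ j then g i j else 0) ≤ c := by
            refine le_trans (Finset.sum_le_sum fun i _ => Finset.sum_le_sum fun j _ => ?_) hgs
            split_ifs
            · exact le_rfl
            · exact hg0 i j
          calc _ = d * (d - 1) * ∑ π : Equiv.Perm A, g (π (ι m)) (π (ι m')) := by ring
            _ = N * ∑ i, ∑ j, (if i ≠ j then g i j else 0) := this
            _ ≤ N * c := mul_le_mul_of_nonneg_left h3 hN0
      rw [← Finset.mul_sum, mul_left_comm]
      refine (mul_le_mul_of_nonneg_left hb hr).trans (le_of_eq ?_)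
      rcases eq_or_ne (s m) 0 with h0 | h0
      · simp [h0]
      · field_simp
    calc _ = ∑ m, ∑ m', d * ∑ π : Equiv.Perm A, p m * p m' / (t * s m) *
          (if m ≠ m' then g (π (ι m)) (π (ι m')) else 0) := by
          rw [Finset.sum_comm, Finset.mul_sum]
          refine Finset.sum_congr rfl fun m _ => ?_
          rw [Finset.sum_comm, Finset.mul_sum]
      _ ≤ ∑ m, ∑ m', p m / s m * p m' * (N * c / (t * (d - 1))) :=
          Finset.sum_le_sum fun m _ => Finset.sum_le_sum fun m' _ => hpair m m'
      _ = (∑ m, p m / s m) * (N * c / (t * (d - 1))) := by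
          simp only [← Finset.sum_mul, ← Finset.mul_sum, hp1, mul_one]
      _ ≤ L * (N * c / (t * (d - 1))) := by
          refine mul_le_mul_of_nonneg_right hL (div_nonneg (by positivity) ?_)
          exact mul_nonneg htp.le (by linarith)
      _ = N * (L * c / (d - 1)) / t := by
          have : d - 1 ≠ 0 := by linarith
          field_simp
      _ = N * t := by rw [← htt]; field_simp
  have hsum := Finset.sum_le_sum fun π (_ : π ∈ (Finset.univ : Finset (Equiv.Perm A))) => hle π
  rw [← Finset.mul_sum, Finset.sum_add_distrib] at hsum
  have := mul_le_mul_of_nonneg_left hsum (by linarith : 0 ≤ d)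
  linarith

end SecondMoment

/-! ### Classical-quantum channels, the pretty good measurement and its error. -/

section Channels

variable {A B M : Type*} [Fintype A] [DecidableEq A] [Fintype B] [DecidableEq B]
  [Fintype M] [DecidableEq M]

theorem choi_apply (T : Matrix A A ℂ →ₗ[ℂ] Matrix B B ℂ) (x y : A × B) :
    choi T x y = (Fintype.card A : ℂ)⁻¹ * T (Matrix.single x.1 y.1 1) x.2 y.2 := by
  have e : (Matrix.of fun a a' => maxEntangled A (a, x.1) (a', y.1))
      = (Fintype.card A : ℂ)⁻¹ • Matrix.single x.1 y.1 (1 : ℂ) := by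
    ext a a'
    simp only [maxEntangled, Matrix.of_apply, Matrix.smul_apply, Matrix.sum_apply,
      Matrix.kroneckerMap_apply]
    congr 1
    rw [Finset.sum_eq_single x.1, Finset.sum_eq_single y.1]
    · simp [Matrix.single_apply]
    · intro j _ hj; simp [Matrix.single_apply, hj]
    · simp
    · intro i _ hi; simp [Matrix.single_apply, hi]
    · simp
  simp only [choi, amplify, Matrix.submatrix_apply, Matrix.of_apply, Prod.fst_swap, Prod.snd_swap]
  rw [e, map_smul, Matrix.smul_apply, smul_eq_mul]

theorem IsCQ.map_single_eq_zero {T : Matrix A A ℂ →ₗ[ℂ] Matrix B B ℂ} (h : IsCQ T) {i j : A}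
    (hij : i ≠ j) : T (Matrix.single i j 1) = 0 := by
  ext b b'
  have := congrFun (congrFun h (i, b)) (j, b')
  rw [choi_apply] at this
  simp only [classicalize, Matrix.of_apply, hij, if_false] at this
  have hc : (Fintype.card A : ℂ)⁻¹ ≠ 0 := by
    have : Nonempty A := ⟨i⟩
    simp
  simpa [hc] using this.symm

theorem IsChannel.isState_single {T : Matrix A A ℂ →ₗ[ℂ] Matrix B B ℂ} (h : IsChannel T) (i : A) :
    IsState (T (Matrix.single i i 1)) := by
  constructor
  · have h1 : (Matrix.single i i (1 : ℂ)).PosSemidef := by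
      rw [← Matrix.diagonal_single]
      refine Matrix.PosSemidef.diagonal fun a => ?_
      by_cases ha : a = i
      · subst ha; simp
      · simp [ha]
    have := (h.completely_positive 1 _ (h1.submatrix Prod.fst)).submatrix (fun b : B => (b, 0))
    exact this
  · rw [h.trace_preserving]; simp

/-- The diagonal blocks of a family of operators. -/
def blockSum (K : M → Matrix B B ℂ) : Matrix (M × B) (M × B) ℂ :=
  Matrix.of fun x y => if x.1 = y.1 then K x.1 x.2 y.2 else 0

theorem blockSum_posSemidef {K : M → Matrix B B ℂ} (hK : ∀ m, (K m).PosSemidef) :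
    (blockSum K).PosSemidef := by
  let E : M → Matrix (M × B) B ℂ := fun m => Matrix.of fun x f => if x = (m, f) then 1 else 0
  have e : blockSum K = ∑ m, E m * K m * (E m)ᴴ := by
    ext x y
    have h : ∀ m, (E m * K m * (E m)ᴴ) x y
        = if x.1 = m then (if y.1 = m then K m x.2 y.2 else 0) else 0 := fun m => by
      obtain ⟨x1, x2⟩ := x
      obtain ⟨y1, y2⟩ := y
      by_cases hx : x1 = m <;> by_cases hy : y1 = m <;>
        simp [Matrix.mul_apply, E, hx, hy, apply_ite, Finset.sum_ite_eq]
    simp only [Matrix.sum_apply, h, Finset.sum_ite_eq, Finset.mem_univ, if_true, blockSum,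
      Matrix.of_apply]
    by_cases hxy : x.1 = y.1
    · rw [if_pos hxy, if_pos hxy.symm]
    · rw [if_neg hxy, if_neg (Ne.symm hxy)]
  rw [e]
  exact Matrix.posSemidef_sum _ fun m _ => (hK m).mul_mul_conjTranspose_same _

/-- The Gram operator of the weighted states `p m • τ m`. -/
noncomputable def gram (p : M → ℝ) (τ : M → Matrix B B ℂ) : Matrix (M × B) (M × B) ℂ :=
  Matrix.of fun x y => (√(p x.1) : ℝ) * (√(p y.1) : ℝ) *
    (CFC.sqrt (τ x.1) * CFC.sqrt (τ y.1)) x.2 y.2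

/-- The error of the pretty good measurement is bounded by the off-diagonal part of the Gram
operator. -/
theorem exists_measurement [Nonempty M] {p : M → ℝ} (hp : ∀ m, 0 ≤ p m) (hp1 : ∑ m, p m = 1)
    {τ : M → Matrix B B ℂ} (hτ : ∀ m, IsState (τ m)) :
    ∃ F : M → Matrix B B ℂ, (∀ m, (F m).PosSemidef) ∧ ∑ m, F m = 1 ∧
      ∃ u : Matrix (M × B) (M × B) ℂ, (1 - u).PosSemidef ∧ (1 + u).PosSemidef ∧
        1 - ∑ m, p m * (F m * τ m).trace.re
          ≤ (u * (gram p τ - classicalize (gram p τ))).trace.re := by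
  have hsq : ∀ m, CFC.sqrt (τ m) * CFC.sqrt (τ m) = τ m :=
    fun m => CFC.sqrt_mul_sqrt_self _ (hτ m).1.nonneg
  have hsh : ∀ m, (CFC.sqrt (τ m))ᴴ = CFC.sqrt (τ m) := fun m => (posSemidef_sqrt _).isHermitian
  set S : Matrix B (M × B) ℂ := Matrix.of fun b x => (√(p x.1) : ℝ) * CFC.sqrt (τ x.1) b x.2
    with hS
  have hG : Sᴴ * S = gram p τ := by
    ext x y
    simp only [Matrix.mul_apply, Matrix.conjTranspose_apply, hS, Matrix.of_apply, gram,
      Finset.mul_sum]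
    refine Finset.sum_congr rfl fun b _ => ?_
    rw [star_mul', ← Matrix.conjTranspose_apply, hsh, Complex.star_def, Complex.conj_ofReal]
    ring
  obtain ⟨U, hU, hU1, -⟩ := exists_polar S
  rw [hG] at hU
  have hGp : (gram p τ).PosSemidef := by
    rw [← hG]; exact Matrix.posSemidef_conjTranspose_mul_self S
  set a := CFC.sqrt (gram p τ) with ha
  have haa : a * a = gram p τ := CFC.sqrt_mul_sqrt_self _ hGp.nonneg
  have hap : a.PosSemidef := posSemidef_sqrt _
  -- The square root of the pinched Gram operator; it has no off-diagonal blocks, so these blocks of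
  -- `a - b` are those of `a`.
  set b := blockSum fun m => ((√(p m) : ℝ) : ℂ) • CFC.sqrt (τ m) with hb
  have hbp : b.PosSemidef := blockSum_posSemidef fun m => (posSemidef_sqrt _).smul
    (by exact_mod_cast Real.sqrt_nonneg _)
  have hbb : b * b = classicalize (gram p τ) := by
    ext x y
    simp only [Matrix.mul_apply, hb, blockSum, Matrix.of_apply, classicalize, gram,
      Fintype.sum_prod_type]
    rw [Finset.sum_eq_single x.1]
    · by_cases h : x.1 = y.1
      · simp only [h, if_true, Matrix.smul_apply, smul_eq_mul, Finset.mul_sum]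
        exact Finset.sum_congr rfl fun _ _ => by ring
      · simp [h]
    · intro m _ hm; simp [hm.symm]
    · simp
  obtain ⟨u, hu1, hu2, hu⟩ := exists_powers_stormer hap hbp
  rw [haa, hbb] at hu
  let Um : M → Matrix B B ℂ := fun m => U.submatrix id (Prod.mk m)
  have hUm : ∑ m, Um m * (Um m)ᴴ = U * Uᴴ := by
    ext i j
    simp only [Matrix.sum_apply, Matrix.mul_apply, Fintype.sum_prod_type, Um,
      Matrix.submatrix_apply, Matrix.conjTranspose_apply, id]
  have hrest : (1 - U * Uᴴ).PosSemidef := by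
    have h := Matrix.posSemidef_self_mul_conjTranspose (1 - U * Uᴴ)
    have e : (1 - U * Uᴴ) * (1 - U * Uᴴ)ᴴ = 1 - U * Uᴴ := by
      rw [Matrix.conjTranspose_sub, Matrix.conjTranspose_one, Matrix.conjTranspose_mul,
        Matrix.conjTranspose_conjTranspose, sub_mul, mul_sub, mul_sub, hU1]
      simp
    rwa [e] at h
  obtain ⟨m₀⟩ := ‹Nonempty M›
  have hE : ∀ m, (Um m * (Um m)ᴴ).PosSemidef :=
    fun m => Matrix.posSemidef_self_mul_conjTranspose _
  -- The column blocks of `U` give a POVM only on the range of `U`; the remaining projection is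
  -- assigned to an arbitrary `m₀`, which can only help.
  refine ⟨fun m => Um m * (Um m)ᴴ + if m = m₀ then 1 - U * Uᴴ else 0, fun m => ?_, ?_,
    u, hu1, hu2, le_trans ?_ hu⟩
  · refine (hE m).add ?_
    split_ifs
    · exact hrest
    · exact Matrix.PosSemidef.zero
  · rw [Finset.sum_add_distrib, hUm]; simp
  have hah : aᴴ = a := hap.isHermitian
  have htot : ∑ x, ∑ y, ‖a x y‖ ^ 2 = 1 := by
    rw [← re_trace_mul_conjTranspose_self, hah, haa, trace_eq_sum_block, Complex.re_sum, ← hp1]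
    refine Finset.sum_congr rfl fun m _ => ?_
    have : block (gram p τ) m m = ((p m : ℝ) : ℂ) • τ m := by
      ext i j
      simp only [block, gram, Matrix.submatrix_apply, Matrix.of_apply, hsq, Matrix.smul_apply,
        smul_eq_mul]
      rw [← Complex.ofReal_mul, Real.mul_self_sqrt (hp m)]
    rw [this, Matrix.trace_smul, (hτ m).2, smul_eq_mul, mul_one, Complex.ofReal_re]
  -- Since `a = U† S`, its `m`-th diagonal block has squared norm `p m tr (Um Um† τ m)`. As `tr a² =
  -- 1`, the off-diagonal mass of `a` bounds the error.
  have hsucc : ∀ m, ∑ i, ∑ j, ‖a (m, i) (m, j)‖ ^ 2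
      ≤ p m * ((Um m * (Um m)ᴴ + if m = m₀ then 1 - U * Uᴴ else 0) * τ m).trace.re := by
    intro m
    have h1 : 0 ≤ ((if m = m₀ then 1 - U * Uᴴ else 0) * τ m).trace.re := by
      split_ifs
      · exact re_trace_mul_nonneg hrest (hτ m).1
      · simp
    have e : block a m m = (Um m)ᴴ * (((√(p m) : ℝ) : ℂ) • CFC.sqrt (τ m)) := by
      rw [← hU]; rfl
    have h2 := re_trace_mul_conjTranspose_self (block a m m)
    have h3 : (block a m m * (block a m m)ᴴ).trace.re
        = p m * (Um m * (Um m)ᴴ * τ m).trace.re := by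
      rw [e, Matrix.conjTranspose_mul, Matrix.conjTranspose_smul, hsh,
        Matrix.conjTranspose_conjTranspose, Complex.star_def, Complex.conj_ofReal,
        show ∀ r : ℂ, (Um m)ᴴ * (r • CFC.sqrt (τ m)) * (r • CFC.sqrt (τ m) * Um m)
          = (r * r) • ((Um m)ᴴ * (CFC.sqrt (τ m) * CFC.sqrt (τ m)) * Um m) from fun r => by
            simp only [Matrix.mul_smul, Matrix.smul_mul, smul_smul, Matrix.mul_assoc], hsq,
        ← Complex.ofReal_mul, Real.mul_self_sqrt (hp m), Matrix.trace_smul, smul_eq_mul,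
        Complex.re_ofReal_mul, Matrix.trace_mul_comm, ← Matrix.mul_assoc]
    rw [h3] at h2
    change _ = ∑ i, ∑ j, ‖a (m, i) (m, j)‖ ^ 2 at h2
    rw [← h2, add_mul, Matrix.trace_add, Complex.add_re]
    exact mul_le_mul_of_nonneg_left (by linarith) (hp m)
  have hdiag : ∑ x : M × B, ∑ y : M × B, (if x.1 = y.1 then ‖a x y‖ ^ 2 else 0)
      = ∑ m, ∑ i, ∑ j, ‖a (m, i) (m, j)‖ ^ 2 := by
    simp only [Fintype.sum_prod_type]
    refine Finset.sum_congr rfl fun m _ => Finset.sum_congr rfl fun i _ => ?_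
    rw [Finset.sum_eq_single m]
    · simp
    · intro m' _ hm; simp [hm.symm]
    · simp
  have hsubh : (a - b)ᴴ = a - b := by
    rw [Matrix.conjTranspose_sub, hah, hbp.isHermitian.eq]
  have hfin : ∑ x : M × B, ∑ y : M × B, (‖a x y‖ ^ 2 - if x.1 = y.1 then ‖a x y‖ ^ 2 else 0)
      ≤ ((a - b) * (a - b)).trace.re := by
    nth_rewrite 2 [← hsubh]
    rw [re_trace_mul_conjTranspose_self]
    refine Finset.sum_le_sum fun x _ => Finset.sum_le_sum fun y _ => ?_
    by_cases h : x.1 = y.1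
    · simp [h]
    · simp [h, hb, blockSum]
  simp only [Finset.sum_sub_distrib, htot, hdiag] at hfin
  exact le_trans (sub_le_sub_left (Finset.sum_le_sum fun m _ => hsucc m) _) hfin

/-- The measurement channel of a POVM. -/
def measure (F : M → Matrix B B ℂ) : Matrix B B ℂ →ₗ[ℂ] Matrix M M ℂ where
  toFun X := Matrix.diagonal fun m => (F m * X).trace
  map_add' X Y := by
    rw [Matrix.diagonal_add]
    simp [Matrix.mul_add]
  map_smul' c X := by
    rw [← Matrix.diagonal_smul]
    congr 1
    ext m
    simp

theorem isChannel_measure {F : M → Matrix B B ℂ} (hF : ∀ m, (F m).PosSemidef)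
    (hF1 : ∑ m, F m = 1) : IsChannel (measure F) := by
  constructor
  · intro k X hX
    have hC : ∀ m, ∃ C : Matrix B B ℂ, F m = Cᴴ * C := fun m =>
      CStarAlgebra.nonneg_iff_eq_star_mul_self.mp (hF m).nonneg
    choose C hC using hC
    let K : M → B → Matrix (M × Fin k) (B × Fin k) ℂ := fun m b =>
      Matrix.of fun x y => if x.1 = m then (if x.2 = y.2 then C m b y.1 else 0) else 0
    have e : amplify (measure F) (Fin k) X = ∑ m, ∑ b, K m b * X * (K m b)ᴴ := by
      ext x y
      obtain ⟨n, r⟩ := x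
      obtain ⟨n', r'⟩ := y
      have hK : ∀ m b, (K m b * X * (K m b)ᴴ) (n, r) (n', r')
          = if n = m then (if n' = m then
            (C m * (Matrix.of fun a a' => X (a, r) (a', r')) * (C m)ᴴ) b b else 0) else 0 := by
        intro m b
        by_cases hn : n = m
        · by_cases hn' : n' = m
          · simp [Matrix.mul_apply, K, hn, hn', Fintype.sum_prod_type, apply_ite,
              Finset.sum_ite_eq]
          · simp [Matrix.mul_apply, K, hn']
        · simp [Matrix.mul_apply, K, hn]
      simp only [Matrix.sum_apply, hK]
      rw [Finset.sum_eq_single n]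
      · simp only [if_true, amplify, measure, LinearMap.coe_mk, AddHom.coe_mk, Matrix.of_apply,
          Matrix.diagonal_apply]
        by_cases h : n = n'
        · subst h
          simp only [if_true]
          rw [hC, Matrix.mul_assoc, Matrix.trace_mul_comm]
          rfl
        · simp [h, Ne.symm h]
      · intro m _ hm; simp [hm.symm]
      · simp
    rw [e]
    exact Matrix.posSemidef_sum _ fun m _ => Matrix.posSemidef_sum _ fun b _ =>
      hX.mul_mul_conjTranspose_same _
  · intro X
    simp only [measure, LinearMap.coe_mk, AddHom.coe_mk, Matrix.trace_diagonal]
    rw [← Matrix.trace_sum, ← Matrix.sum_mul, hF1, one_mul]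

theorem traceNorm_diagonal {n : Type*} [Fintype n] [DecidableEq n] (f : n → ℝ) :
    traceNorm (Matrix.diagonal fun x => (f x : ℂ)) = ∑ x, |f x| := by
  have h : CFC.sqrt ((Matrix.diagonal fun x => (f x : ℂ))ᴴ * Matrix.diagonal fun x => (f x : ℂ))
      = Matrix.diagonal fun x => ((|f x| : ℝ) : ℂ) := by
    refine CFC.sqrt_unique ?_ ?_
    · rw [Matrix.diagonal_conjTranspose, Matrix.diagonal_mul_diagonal, Matrix.diagonal_mul_diagonal]
      congr 1
      ext x
      rw [← Complex.ofReal_mul, abs_mul_abs_self]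
      simp
    · rw [Matrix.nonneg_iff_posSemidef]
      exact Matrix.PosSemidef.diagonal fun x => by
        simp only [Pi.zero_apply]; exact_mod_cast abs_nonneg (f x)
  rw [traceNorm, h, Matrix.trace_diagonal, Complex.re_sum]
  simp

theorem conjFirst_messageVec_apply (p : M → ℝ) (π : Equiv.Perm A) (ι : M ↪ A) (a a' : A)
    (r r' : M) :
    conjFirst (permOp π * embedOp ι) (pureState (messageVec p)) (a, r) (a', r')
      = if a = π (ι r) ∧ a' = π (ι r') then ((√(p r) * √(p r') : ℝ) : ℂ) else 0 := by
  have hW : ∀ a m, (permOp π * embedOp ι) a m = if a = π (ι m) then 1 else 0 := fun a m => by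
    simp [Matrix.mul_apply, permOp, embedOp]
  have hv : ∀ a r, ((permOp π * embedOp ι) ⊗ₖ (1 : Matrix M M ℂ)).mulVec (messageVec p) (a, r)
      = if a = π (ι r) then ((√(p r) : ℝ) : ℂ) else 0 := fun a r => by
    simp only [Matrix.mulVec, dotProduct, Matrix.kroneckerMap_apply, hW, messageVec,
      Fintype.sum_prod_type, Matrix.one_apply]
    rw [Finset.sum_eq_single r]
    · simp
    · intro m _ hm
      simp [hm.symm]
    · simp
  rw [conjFirst, pureState, Matrix.mul_vecMulVec, Matrix.vecMulVec_mul, Matrix.vecMulVec_apply,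
    hv, ← Matrix.star_mulVec, Pi.star_apply, hv]
  by_cases h : a = π (ι r) <;> by_cases h' : a' = π (ι r') <;> simp [h, h']

/-- The decoding error of a measurement. -/
theorem traceNorm_measure_eq {T : Matrix A A ℂ →ₗ[ℂ] Matrix B B ℂ} (hT : IsChannel T)
    (hCQ : IsCQ T) {p : M → ℝ} (hp : ∀ m, 0 ≤ p m) (hp1 : ∑ m, p m = 1) (ι : M ↪ A)
    (π : Equiv.Perm A) {F : M → Matrix B B ℂ} (hF : ∀ m, (F m).PosSemidef)
    (hF1 : ∑ m, F m = 1) :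
    traceNorm (amplify (measure F ∘ₗ T) M (conjFirst (permOp π * embedOp ι)
        (pureState (messageVec p))) - classicalize (pureState (messageVec p)))
      = 2 * (1 - ∑ m, p m * (F m * T (Matrix.single (π (ι m)) (π (ι m)) 1)).trace.re) := by
  set τ : M → Matrix B B ℂ := fun m => T (Matrix.single (π (ι m)) (π (ι m)) 1) with hτ
  have hst : ∀ m, IsState (τ m) := fun m => hT.isState_single _
  set q : M → M → ℝ := fun n m => (F n * τ m).trace.re with hq
  have hreal : ∀ n m, (F n * τ m).trace = (q n m : ℂ) := fun n m => by
    have : (starRingEnd ℂ) (F n * τ m).trace = (F n * τ m).trace := by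
      rw [← Complex.star_def, ← Matrix.trace_conjTranspose, Matrix.conjTranspose_mul,
        (hst m).1.isHermitian.eq, (hF n).isHermitian.eq, Matrix.trace_mul_comm]
    exact (Complex.conj_eq_iff_re.mp this).symm
  have hq0 : ∀ n m, 0 ≤ q n m := fun n m => re_trace_mul_nonneg (hF n) (hst m).1
  have hq1 : ∀ m, ∑ n, q n m = 1 := fun m => by
    rw [← Complex.re_sum, ← Matrix.trace_sum, ← Matrix.sum_mul, hF1, one_mul, (hst m).2,
      Complex.one_re]
  have hX : amplify (measure F ∘ₗ T) M (conjFirst (permOp π * embedOp ι)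
        (pureState (messageVec p))) - classicalize (pureState (messageVec p))
      = Matrix.diagonal fun x : M × M =>
        ((p x.2 * (q x.1 x.2 - if x.1 = x.2 then 1 else 0) : ℝ) : ℂ) := by
    ext x y
    obtain ⟨n, r⟩ := x
    obtain ⟨n', r'⟩ := y
    have e : (Matrix.of fun a a' => conjFirst (permOp π * embedOp ι) (pureState (messageVec p))
        (a, r) (a', r')) = ((√(p r) * √(p r') : ℝ) : ℂ) •
          Matrix.single (π (ι r)) (π (ι r')) (1 : ℂ) := by
      ext a a'
      simp only [Matrix.of_apply, conjFirst_messageVec_apply, Matrix.smul_apply,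
        Matrix.single_apply, smul_eq_mul, eq_comm, mul_ite, mul_one, mul_zero]
    simp only [Matrix.sub_apply, amplify, Matrix.of_apply, LinearMap.comp_apply]
    rw [e, map_smul, map_smul, Matrix.smul_apply]
    by_cases hr : r = r'
    · subst hr
      rw [Real.mul_self_sqrt (hp r)]
      by_cases hn : n = n'
      · subst hn
        simp only [measure, LinearMap.coe_mk, AddHom.coe_mk, Matrix.diagonal_apply, if_true,
          classicalize, Matrix.of_apply, pureState, Matrix.vecMulVec_apply, messageVec,
          Pi.star_apply]
        have := hreal n r
        simp only [hτ] at this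
        rw [this]
        by_cases hnr : n = r
        · subst hnr
          simp only [if_true, Complex.star_def, Complex.conj_ofReal]
          rw [← Complex.ofReal_mul, Real.mul_self_sqrt (hp n)]
          push_cast
          simp only [smul_eq_mul]
          ring
        · simp [hnr]
      · simp [measure, hn, classicalize]
    · rw [hCQ.map_single_eq_zero (fun h => hr (ι.injective (π.injective h)))]
      have h1 : ¬ ((n, r) = (n', r')) := fun h => hr (Prod.ext_iff.mp h).2
      rw [Matrix.diagonal_apply, if_neg h1]
      simp only [map_zero, Matrix.zero_apply, smul_zero, classicalize, Matrix.of_apply, pureState,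
        Matrix.vecMulVec_apply, messageVec, Pi.star_apply, zero_sub, neg_eq_zero]
      by_cases hn : n = n'
      · subst hn
        by_cases hnr : n = r
        · subst hnr; simp [hr]
        · simp [hnr]
      · simp [hn]
  rw [hX, traceNorm_diagonal, Fintype.sum_prod_type, Finset.sum_comm]
  -- The `ℓ¹` distance of a probability vector from a point mass is twice the mass off the point.
  have hr : ∀ r, ∑ n, |p r * (q n r - if n = r then 1 else 0)| = 2 * (p r - p r * q r r) := by
    intro r
    have hle : q r r ≤ 1 := by
      rw [← hq1 r]
      exact Finset.single_le_sum (f := fun n => q n r) (fun n _ => hq0 n r) (Finset.mem_univ r)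
    have h1 : ∀ n, |p r * (q n r - if n = r then 1 else 0)|
        = p r * q n r + if n = r then p r * (1 - 2 * q r r) else 0 := fun n => by
      rw [abs_mul, abs_of_nonneg (hp r)]
      by_cases h : n = r
      · subst h
        rw [if_pos rfl, if_pos rfl, abs_of_nonpos (by linarith)]; ring
      · rw [if_neg h, if_neg h, sub_zero, abs_of_nonneg (hq0 n r), add_zero]
    simp only [h1, Finset.sum_add_distrib, ← Finset.mul_sum, hq1, Finset.sum_ite_eq',
      Finset.mem_univ, if_true]
    ring
  simp only [hr]
  rw [← Finset.mul_sum, Finset.sum_sub_distrib, hp1]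

end Channels

/-! ### The complementary state and operator bounds extracted from the entropies. -/

section Entropies

variable {A B C M : Type*} [Fintype A] [DecidableEq A] [Fintype B] [DecidableEq B]
  [Fintype C] [DecidableEq C] [Fintype M] [DecidableEq M]

theorem reducedAC_apply (ψ : (A × B) × C → ℂ) (x y : A × C) :
    reducedAC ψ x y = ∑ b, ψ ((x.1, b), x.2) * star (ψ ((y.1, b), y.2)) := rfl

theorem reducedAC_posSemidef (ψ : (A × B) × C → ℂ) : (reducedAC ψ).PosSemidef := by
  have e : reducedAC ψ = ∑ b, Matrix.vecMulVec (fun x : A × C => ψ ((x.1, b), x.2))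
      (star fun x : A × C => ψ ((x.1, b), x.2)) := by
    ext x y
    simp [reducedAC_apply, Matrix.sum_apply, Matrix.vecMulVec_apply]
  rw [e]
  exact Matrix.posSemidef_sum _ fun b _ => Matrix.posSemidef_vecMulVec_self_star _

theorem trace_reducedAC_purify {ρ : Matrix (A × B) (A × B) ℂ} (hρ : ρ.PosSemidef) :
    (reducedAC (purify ρ)).trace = ρ.trace := by
  conv_rhs => rw [← partialTrace_purify ρ hρ]
  simp only [Matrix.trace, Matrix.diag_apply, reducedAC_apply, partialTrace, pureState,
    Matrix.of_apply, Matrix.vecMulVec_apply, Pi.star_apply]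
  rw [Fintype.sum_prod_type]
  conv_rhs => rw [Fintype.sum_prod_type]
  exact Finset.sum_congr rfl fun a _ => Finset.sum_comm

theorem choi_eq_blockSum {T : Matrix A A ℂ →ₗ[ℂ] Matrix B B ℂ} (hCQ : IsCQ T) :
    choi T = blockSum fun i => ((Fintype.card A : ℝ)⁻¹ : ℂ) • T (Matrix.single i i 1) := by
  ext x y
  rw [choi_apply]
  by_cases h : x.1 = y.1
  · simp [blockSum, h]
  · simp [blockSum, h, hCQ.map_single_eq_zero h]

theorem sqrt_choi {T : Matrix A A ℂ →ₗ[ℂ] Matrix B B ℂ} (hT : IsChannel T) (hCQ : IsCQ T) :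
    CFC.sqrt (choi T) = blockSum fun i =>
      ((√(Fintype.card A : ℝ)⁻¹ : ℝ) : ℂ) • CFC.sqrt (T (Matrix.single i i 1)) := by
  refine CFC.sqrt_unique ?_ ?_
  · rw [choi_eq_blockSum hCQ]
    ext x y
    simp only [Matrix.mul_apply, blockSum, Matrix.of_apply, Fintype.sum_prod_type]
    rw [Finset.sum_eq_single x.1]
    · by_cases h : x.1 = y.1
      · simp only [h, if_true]
        rw [← Matrix.mul_apply, Matrix.smul_mul, Matrix.mul_smul, smul_smul, ← Complex.ofReal_mul,
          Real.mul_self_sqrt (by positivity), CFC.sqrt_mul_sqrt_self _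
          (hT.isState_single _).1.nonneg, Complex.ofReal_inv]
      · simp [h]
    · intro m _ hm; simp [hm.symm]
    · simp
  · exact (blockSum_posSemidef fun i => (posSemidef_sqrt _).smul
      (by exact_mod_cast Real.sqrt_nonneg _)).nonneg

theorem isState_reducedAC_choi [Nonempty A] {T : Matrix A A ℂ →ₗ[ℂ] Matrix B B ℂ}
    (hT : IsChannel T) (hCQ : IsCQ T) : IsState (reducedAC (purify (choi T))) := by
  refine ⟨reducedAC_posSemidef _, ?_⟩
  have hpsd : (choi T).PosSemidef := by
    rw [choi_eq_blockSum hCQ]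
    refine blockSum_posSemidef fun i => (hT.isState_single i).1.smul ?_
    have : (0 : ℝ) ≤ (Fintype.card A : ℝ)⁻¹ := by positivity
    exact_mod_cast this
  rw [trace_reducedAC_purify hpsd, trace_eq_sum_block]
  have : ∀ i, (block (choi T) i i).trace = (Fintype.card A : ℂ)⁻¹ := fun i => by
    have e : block (choi T) i i = (Fintype.card A : ℂ)⁻¹ • T (Matrix.single i i 1) := by
      ext b b'
      simp [block, choi_apply]
    rw [e, Matrix.trace_smul, (hT.isState_single i).2, smul_eq_mul, mul_one]
  simp [this]

/-- The bridge from coding to decoupling: tracing `B` out of the standard purification leaves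
overlaps of the roots of the output states, with the order reversed. This is why a transpose appears
later. -/
theorem reducedAC_choi_copyFst {T : Matrix A A ℂ →ₗ[ℂ] Matrix B B ℂ} (hT : IsChannel T)
    (hCQ : IsCQ T) (x y : A × B) :
    reducedAC (purify (choi T)) (copyFst x) (copyFst y) = (Fintype.card A : ℂ)⁻¹ *
      (CFC.sqrt (T (Matrix.single y.1 y.1 1)) * CFC.sqrt (T (Matrix.single x.1 x.1 1))) y.2 x.2 := by
  rw [reducedAC_apply, Matrix.mul_apply, Finset.mul_sum]
  refine Finset.sum_congr rfl fun b _ => ?_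
  have hh := (posSemidef_sqrt (T (Matrix.single y.1 y.1 1))).isHermitian.apply y.2 b
  have hd : ((√(Fintype.card A : ℝ)⁻¹ : ℝ) : ℂ) * ((√(Fintype.card A : ℝ)⁻¹ : ℝ) : ℂ)
      = (Fintype.card A : ℂ)⁻¹ := by
    rw [← Complex.ofReal_mul, Real.mul_self_sqrt (by positivity)]
    simp
  simp only [purify, copyFst, sqrt_choi hT hCQ, blockSum, Matrix.of_apply, if_true,
    Matrix.smul_apply, smul_eq_mul, star_mul', Complex.star_def, Complex.conj_ofReal] at hh ⊢
  rw [hh, ← hd]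
  ring

theorem exists_le_smul_one (ρ : Matrix A A ℂ) (hρ : ρ.PosSemidef) :
    ∃ c : ℝ, 0 < c ∧ ρ ≤ c • (1 : Matrix A A ℂ) := by
  obtain ⟨c, hc⟩ := (Matrix.finite_real_spectrum (A := ρ)).bddAbove
  have hsa : IsSelfAdjoint ρ := hρ.isHermitian
  refine ⟨max c 1, by positivity, ?_⟩
  have h := cfc_mono (R := ℝ) (f := fun x => x) (g := fun _ => max c 1) (a := ρ)
    (fun x hx => (hc hx).trans (le_max_left _ _))
  rw [cfc_id' ℝ ρ, cfc_const _ ρ, Algebra.algebraMap_eq_smul_one] at h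
  exact h

theorem isState_smul_one [Nonempty B] :
    IsState (((Fintype.card B : ℝ)⁻¹ : ℝ) • (1 : Matrix B B ℂ)) := by
  refine ⟨Matrix.PosSemidef.one.smul (by positivity), ?_⟩
  rw [Matrix.trace_smul, Matrix.trace_one, Complex.real_smul]
  simp

theorem exists_of_lt_minEntropy [Nonempty B] {ρ : Matrix (A × B) (A × B) ℂ} (hρ : ρ.PosSemidef)
    {l : ℝ} (hl : l < minEntropy ρ) :
    ∃ l' > l, ∃ σ : Matrix B B ℂ, IsState σ ∧
      ρ ≤ ((2 : ℝ) ^ (-l')) • ((1 : Matrix A A ℂ) ⊗ₖ σ) := by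
  have hne : {lam : ℝ | ∃ σ : Matrix B B ℂ, IsState σ ∧
      ρ ≤ ((2 : ℝ) ^ (-lam)) • ((1 : Matrix A A ℂ) ⊗ₖ σ)}.Nonempty := by
    obtain ⟨c, hc, h⟩ := exists_le_smul_one ρ hρ
    have hB : (0 : ℝ) < Fintype.card B := by exact_mod_cast Fintype.card_pos
    refine ⟨-Real.logb 2 (c * Fintype.card B), _, isState_smul_one, ?_⟩
    rw [neg_neg, Real.rpow_logb (by norm_num) (by norm_num) (by positivity), Matrix.kronecker_smul,
      smul_smul, Matrix.one_kronecker_one, mul_assoc, mul_inv_cancel₀ hB.ne', mul_one]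
    exact h
  obtain ⟨l', hl', hlt⟩ := exists_lt_of_lt_csSup hne hl
  exact ⟨l', hlt, hl'⟩

/-- The strict inequality leaves room to mix a little of the maximally mixed state into `σ`, making
it invertible. -/
theorem exists_posDef_of_lt_minEntropy [Nonempty B] {ρ : Matrix (A × B) (A × B) ℂ}
    (hρ : ρ.PosSemidef) {l : ℝ} (hl : l < minEntropy ρ) :
    ∃ σ : Matrix B B ℂ, σ.PosDef ∧ σ.trace = 1 ∧
      ρ ≤ ((2 : ℝ) ^ (-l)) • ((1 : Matrix A A ℂ) ⊗ₖ σ) := by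
  obtain ⟨l', hl', σ, hσ, h⟩ := exists_of_lt_minEntropy hρ hl
  -- Chosen so that `2^(-l) θ = 2^(-l')`: the `σ` part of the mixture alone dominates `ρ`.
  set θ : ℝ := (2 : ℝ) ^ (l - l') with hθ
  have hθ0 : 0 < θ := by positivity
  have hθ1 : θ < 1 := Real.rpow_lt_one_of_one_lt_of_neg (by norm_num) (by linarith)
  set η : Matrix B B ℂ := ((Fintype.card B : ℝ)⁻¹ : ℝ) • (1 : Matrix B B ℂ) with hη
  have hηd : η.PosDef := Matrix.PosDef.one.smul
    (inv_pos.mpr (by exact_mod_cast Fintype.card_pos))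
  refine ⟨θ • σ + (1 - θ) • η, ?_, ?_, ?_⟩
  · exact Matrix.PosDef.posSemidef_add (hσ.1.smul hθ0.le) (hηd.smul (by linarith))
  · rw [Matrix.trace_add, Matrix.trace_smul, Matrix.trace_smul, hσ.2,
      (isState_smul_one (B := B)).2]
    simp
  · refine h.trans ?_
    rw [Matrix.kronecker_add, Matrix.kronecker_smul, smul_add, smul_smul, hθ,
      ← Real.rpow_add (by norm_num), show -l + (l - l') = -l' by ring]
    refine le_add_of_nonneg_right (Matrix.PosSemidef.nonneg ?_)
    refine Matrix.PosSemidef.smul ?_ (by positivity)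
    exact Matrix.PosSemidef.kronecker .one (hηd.smul (by linarith)).posSemidef

theorem purifiedDistance_self {ρ : Matrix A A ℂ} (hρ : IsState ρ) : purifiedDistance ρ ρ = 0 := by
  have h1 : CFC.sqrt ρ * CFC.sqrt ρ = ρ := CFC.sqrt_mul_sqrt_self ρ hρ.1.nonneg
  have h2 : CFC.sqrt (ρᴴ * ρ) = ρ := CFC.sqrt_unique (by rw [hρ.1.isHermitian.eq]) hρ.1.nonneg
  simp [purifiedDistance, genFidelity, fidelity, traceNorm, h1, h2, hρ.2]

theorem exists_of_lt_smoothMinEntropy [Nonempty B] {ρ : Matrix (A × B) (A × B) ℂ}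
    (hρ : IsState ρ) {ε : ℝ} (hε : 0 ≤ ε) {l : ℝ} (hl : l < smoothMinEntropy ε ρ) :
    ∃ ρ' : Matrix (A × B) (A × B) ℂ, IsSubState ρ' ∧ purifiedDistance ρ ρ' ≤ ε ∧
      ∃ σ : Matrix B B ℂ, σ.PosDef ∧ σ.trace = 1 ∧
        ρ' ≤ ((2 : ℝ) ^ (-l)) • ((1 : Matrix A A ℂ) ⊗ₖ σ) := by
  have hne : (minEntropy '' {ρ' | IsSubState ρ' ∧ purifiedDistance ρ ρ' ≤ ε}).Nonempty :=
    ⟨_, ρ, ⟨⟨hρ.1, hρ.2.le⟩, by rw [purifiedDistance_self hρ]; exact hε⟩, rfl⟩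
  obtain ⟨_, ⟨ρ', ⟨h1, h2⟩, rfl⟩, hlt⟩ := exists_lt_of_lt_csSup hne hl
  exact ⟨ρ', h1, h2, exists_posDef_of_lt_minEntropy h1.1 hlt⟩

theorem partialTrace_messageVec {p : M → ℝ} (hp : ∀ m, 0 ≤ p m) :
    partialTrace (pureState (messageVec p)) = Matrix.diagonal fun m => (p m : ℂ) := by
  ext m m'
  simp only [partialTrace, Matrix.of_apply, pureState, Matrix.vecMulVec_apply, messageVec,
    Pi.star_apply, Matrix.diagonal_apply]
  rw [Finset.sum_eq_single m]
  · by_cases h : m = m'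
    · subst h
      simp only [if_true, Complex.star_def, Complex.conj_ofReal]
      rw [← Complex.ofReal_mul, Real.mul_self_sqrt (hp m)]
    · simp [h, Ne.symm h]
  · intro b _ hb; simp [hb.symm]
  · simp

theorem reducedAC_message_apply {p : M → ℝ} (hp : ∀ m, 0 ≤ p m) (m m' : M) :
    reducedAC (purify ((partialTrace (pureState (messageVec p))).submatrix
      (Prod.fst : M × Unit → M) Prod.fst)) (m, (m, ())) (m', (m', ()))
      = ((√(p m) * √(p m') : ℝ) : ℂ) := by
  have h : CFC.sqrt ((partialTrace (pureState (messageVec p))).submatrix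
      (Prod.fst : M × Unit → M) Prod.fst)
      = Matrix.diagonal fun x : M × Unit => ((√(p x.1) : ℝ) : ℂ) := by
    refine CFC.sqrt_unique ?_ ?_
    · rw [partialTrace_messageVec hp, Matrix.diagonal_mul_diagonal]
      ext x y
      simp only [Matrix.diagonal_apply, Matrix.submatrix_apply, Prod.ext_iff, and_true]
      by_cases hxy : x.1 = y.1
      · rw [if_pos hxy, if_pos hxy, ← Complex.ofReal_mul, Real.mul_self_sqrt (hp _)]
      · rw [if_neg hxy, if_neg hxy]
    · exact Matrix.PosSemidef.nonneg (Matrix.PosSemidef.diagonal fun x => by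
        simp only [Pi.zero_apply]; exact_mod_cast Real.sqrt_nonneg _)
  rw [reducedAC_apply]
  simp [purify, h]

/-- The weights are the diagonal of the optimising `σ`. Testing the operator bound on `√(p m) / s m`
along the vectors `|m, m⟩` gives `L² ≤ c L` for `L = ∑ p m / s m`. -/
theorem exists_weights_of_lt_minEntropy {p : M → ℝ} (hp : ∀ m, 0 ≤ p m) [Nonempty M]
    {l : ℝ} (hl : l < minEntropy (reducedAC (purify ((partialTrace
      (pureState (messageVec p))).submatrix (Prod.fst : M × Unit → M) Prod.fst)))) :
    ∃ s : M → ℝ, (∀ m, 0 ≤ s m) ∧ ∑ m, s m = 1 ∧ (∀ m, s m = 0 → p m = 0) ∧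
      ∑ m, p m / s m ≤ (2 : ℝ) ^ (-l) := by
  obtain ⟨σ, hσ, hσ1, h⟩ := exists_posDef_of_lt_minEntropy (reducedAC_posSemidef _) hl
  set c := (2 : ℝ) ^ (-l) with hc
  have hc0 : 0 < c := by positivity
  set s : M → ℝ := fun m => (σ (m, ()) (m, ())).re with hs
  have hs0 : ∀ m, 0 < s m := fun m => (Complex.lt_def.mp (hσ.diag_pos (i := (m, ())))).1
  refine ⟨s, fun m => (hs0 m).le, ?_, fun m hm => absurd hm (hs0 m).ne', ?_⟩
  · have := congrArg Complex.re hσ1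
    simpa [Matrix.trace, Fintype.sum_prod_type] using this
  have h' := (Matrix.le_iff.mp h).submatrix (fun m : M => (m, (m, ())))
  have hq := (Complex.le_def.mp (h'.dotProduct_mulVec_nonneg
    (fun m => ((√(p m) / s m : ℝ) : ℂ)))).1
  have e : (star (fun m => ((√(p m) / s m : ℝ) : ℂ)) ⬝ᵥ ((c • ((1 : Matrix M M ℂ) ⊗ₖ σ) -
      reducedAC (purify ((partialTrace (pureState (messageVec p))).submatrix
      (Prod.fst : M × Unit → M) Prod.fst))).submatrix (fun m : M => (m, (m, ())))
      (fun m : M => (m, (m, ())))).mulVec fun m => ((√(p m) / s m : ℝ) : ℂ)).re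
      = c * (∑ m, p m / s m) - (∑ m, p m / s m) ^ 2 := by
    have e1 : ∀ m m', ((c • ((1 : Matrix M M ℂ) ⊗ₖ σ) -
      reducedAC (purify ((partialTrace (pureState (messageVec p))).submatrix
      (Prod.fst : M × Unit → M) Prod.fst))) (m, (m, ())) (m', (m', ()))).re
        = (if m = m' then c * s m else 0) - √(p m) * √(p m') := fun m m' => by
      rw [Matrix.sub_apply, reducedAC_message_apply hp, Complex.sub_re, Complex.ofReal_re]
      congr 1
      by_cases hm : m = m'
      · subst hm; simp [hs]
      · simp [hm]
    simp only [dotProduct, Matrix.mulVec, Pi.star_apply, Complex.star_def, Complex.conj_ofReal,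
      Complex.re_sum, Complex.re_ofReal_mul, Complex.re_mul_ofReal, Matrix.submatrix_apply, e1]
    have e2 : ∀ m, √(p m) / s m * √(p m) = p m / s m := fun m => by
      rw [div_mul_eq_mul_div, Real.mul_self_sqrt (hp m)]
    have e3 : ∀ m, √(p m) / s m * ∑ m', ((if m = m' then c * s m else 0) - √(p m) * √(p m')) *
        (√(p m') / s m') = c * (p m / s m) - (p m / s m) * ∑ m', p m' / s m' := fun m => by
      have : ∀ m', ((if m = m' then c * s m else 0) - √(p m) * √(p m')) * (√(p m') / s m')
          = (if m = m' then c * √(p m) else 0) - √(p m) * (p m' / s m') := fun m' => by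
        rw [← e2 m']
        by_cases hm : m = m'
        · subst hm
          have := (hs0 m).ne'
          simp only [if_true]
          field_simp
        · simp only [hm, if_false]; ring
      simp only [this, Finset.sum_sub_distrib, Finset.sum_ite_eq, Finset.mem_univ, if_true,
        ← Finset.mul_sum]
      rw [mul_sub, mul_left_comm, e2, ← mul_assoc, e2]
    simp only [e3, Finset.sum_sub_distrib, ← Finset.mul_sum, ← Finset.sum_mul]
    ring
  rw [e, Complex.zero_re] at hq
  set L := ∑ m, p m / s m
  have hL : 0 ≤ L := Finset.sum_nonneg fun m _ => div_nonneg (hp m) (hs0 m).le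
  rcases hL.eq_or_lt with h0 | h0
  · rw [← h0]; exact hc0.le
  · nlinarith

end Entropies

/-! ### The random coding bound before the entropies are attained. -/

section Coding

variable {A B M : Type*} [Fintype A] [DecidableEq A] [Fintype B] [DecidableEq B]
  [Fintype M] [DecidableEq M]

theorem trace_mul_classicalize (X Y : Matrix (M × B) (M × B) ℂ) :
    (X * classicalize Y).trace = (classicalize X * Y).trace := by
  simp only [Matrix.trace, Matrix.diag_apply, Matrix.mul_apply, classicalize, Matrix.of_apply]
  refine Finset.sum_congr rfl fun x _ => Finset.sum_congr rfl fun y _ => ?_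
  by_cases h : x.1 = y.1
  · simp [h]
  · simp [h, Ne.symm h]

theorem gram_eq_smul_transpose [Nonempty A] {T : Matrix A A ℂ →ₗ[ℂ] Matrix B B ℂ}
    (hT : IsChannel T) (hCQ : IsCQ T) (p : M → ℝ) (c : M → A) :
    gram p (fun m => T (Matrix.single (c m) (c m) 1)) = ((Fintype.card A : ℝ) : ℂ) •
      (codeOp B p c * reducedAC (purify (choi T)) * (codeOp B p c)ᴴ)ᵀ := by
  ext x y
  have hd : (Fintype.card A : ℂ) ≠ 0 := by simp
  rw [Matrix.smul_apply, Matrix.transpose_apply, codeOp_mul_mul_apply,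
    reducedAC_choi_copyFst hT hCQ]
  simp only [gram, Matrix.of_apply, smul_eq_mul, Complex.ofReal_natCast]
  field_simp

/-- Pinching is self-adjoint for the trace pairing, so it moves from the Gram operator to the test
operator, as does the transpose. -/
theorem re_trace_mul_gram [Nonempty A] {T : Matrix A A ℂ →ₗ[ℂ] Matrix B B ℂ}
    (hT : IsChannel T) (hCQ : IsCQ T) (p : M → ℝ) (c : M → A) (u : Matrix (M × B) (M × B) ℂ) :
    (u * (gram p (fun m => T (Matrix.single (c m) (c m) 1)) -
      classicalize (gram p (fun m => T (Matrix.single (c m) (c m) 1))))).trace.re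
      = Fintype.card A * ((uᵀ - classicalize uᵀ) * (codeOp B p c * reducedAC (purify (choi T)) *
        (codeOp B p c)ᴴ)).trace.re := by
  set Z := codeOp B p c * reducedAC (purify (choi T)) * (codeOp B p c)ᴴ with hZ
  have hc : classicalize uᵀ = (classicalize u)ᵀ := by
    ext x y; simp [classicalize, eq_comm]
  have ht : ((u - classicalize u) * Zᵀ).trace = ((u - classicalize u)ᵀ * Z).trace := by
    have := Matrix.trace_transpose_mul (u - classicalize u) Zᵀ
    rwa [Matrix.transpose_transpose, eq_comm] at this
  rw [Matrix.mul_sub, Matrix.trace_sub, trace_mul_classicalize, ← Matrix.trace_sub,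
    ← Matrix.sub_mul, gram_eq_smul_transpose hT hCQ, hc, ← Matrix.transpose_sub,
    Matrix.mul_smul, Matrix.trace_smul, smul_eq_mul, Complex.re_ofReal_mul, ← hZ, ht]

theorem sum_re_trace_gram_le {T : Matrix A A ℂ →ₗ[ℂ] Matrix B B ℂ} (hA : 2 ≤ Fintype.card A)
    (hT : IsChannel T) (hCQ : IsCQ T) {p : M → ℝ} (hp : ∀ m, 0 ≤ p m) (hp1 : ∑ m, p m = 1)
    (ι : M ↪ A) {ε : ℝ} (hε : 0 ≤ ε) {u : Equiv.Perm A → Matrix (M × B) (M × B) ℂ}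
    (h1 : ∀ π, (1 - u π).PosSemidef) (h2 : ∀ π, (1 + u π).PosSemidef) {l k : ℝ}
    (hl : l < smoothMinEntropy ε (reducedAC (purify (choi T))))
    (hk : k < minEntropy (reducedAC (purify ((partialTrace
      (pureState (messageVec p))).submatrix (Prod.fst : M × Unit → M) Prod.fst)))) :
    ∑ π : Equiv.Perm A, (u π * (gram p (fun m => T (Matrix.single (π (ι m)) (π (ι m)) 1)) -
      classicalize (gram p (fun m => T (Matrix.single (π (ι m)) (π (ι m)) 1))))).trace.re
      ≤ (Fintype.card (Equiv.Perm A) : ℝ) *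
        (√((2 : ℝ) ^ (-k) * (2 : ℝ) ^ (-l) / (Fintype.card A - 1)) + 4 * ε) := by
  have hAne : Nonempty A := Fintype.card_pos_iff.mp (by omega)
  have hBne : Nonempty B := by
    by_contra hB
    rw [not_nonempty_iff] at hB
    have := (hT.isState_single (Classical.arbitrary A)).2
    simp [Matrix.trace] at this
  have hMne : Nonempty M := by
    by_contra hM
    rw [not_nonempty_iff] at hM
    simp at hp1
  set ω := reducedAC (purify (choi T))
  have hω : IsState ω := isState_reducedAC_choi hT hCQ
  obtain ⟨ω', hω', hdist, σ, hσ, hσ1, hle⟩ := exists_of_lt_smoothMinEntropy hω hε hl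
  obtain ⟨s, hs, hs1, hps, hL⟩ := exists_weights_of_lt_minEntropy hp hk
  have t1 : ∀ π, (1 - (u π)ᵀ).PosSemidef := fun π => by
    have := (h1 π).transpose
    rwa [Matrix.transpose_sub, Matrix.transpose_one] at this
  have t2 : ∀ π, (1 + (u π)ᵀ).PosSemidef := fun π => by
    have := (h2 π).transpose
    rwa [Matrix.transpose_add, Matrix.transpose_one] at this
  have hmain := re_trace_offdiag_sum_le hp hp1 hs hs1 hps (by positivity : (0 : ℝ) < 2 ^ (-k)) hL ι
    hA hω' hσ hσ1 (by positivity : (0 : ℝ) < 2 ^ (-l)) hle t1 t2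
  have c1 : ∀ π, (1 - classicalize (u π)ᵀ).PosSemidef := fun π => by
    have := classicalize_posSemidef (t1 π)
    rwa [classicalize_sub, classicalize_one] at this
  have c2 : ∀ π, (1 + classicalize (u π)ᵀ).PosSemidef := fun π => by
    have := classicalize_posSemidef (t2 π)
    rwa [classicalize_add, classicalize_one] at this
  have hd := re_trace_sum_code_le hp hp1 ι hω hω' t1 t2
  have hd' := re_trace_sum_code_le hp hp1 ι hω hω' (v := fun π => -classicalize (u π)ᵀ)
    (fun π => by rw [sub_neg_eq_add]; exact c2 π) (fun π => by rw [← sub_eq_add_neg]; exact c1 π)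
  -- Split `ω = ω' + (ω - ω')`. In the difference, `u` and its pinching are estimated separately,
  -- each costing `2ε`.
  have e : ∑ π : Equiv.Perm A, (u π * (gram p (fun m => T (Matrix.single (π (ι m)) (π (ι m)) 1)) -
      classicalize (gram p (fun m => T (Matrix.single (π (ι m)) (π (ι m)) 1))))).trace.re
      = Fintype.card A * ∑ π : Equiv.Perm A, (((u π)ᵀ - classicalize (u π)ᵀ) *
          (codeOp B p (fun m => π (ι m)) * ω' * (codeOp B p (fun m => π (ι m)))ᴴ)).trace.re
        + Fintype.card A * ∑ π : Equiv.Perm A, ((u π)ᵀ *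
          (codeOp B p (fun m => π (ι m)) * (ω - ω') * (codeOp B p (fun m => π (ι m)))ᴴ)).trace.re
        + Fintype.card A * ∑ π : Equiv.Perm A, ((-classicalize (u π)ᵀ) *
          (codeOp B p (fun m => π (ι m)) * (ω - ω') *
            (codeOp B p (fun m => π (ι m)))ᴴ)).trace.re := by
    rw [← mul_add, ← mul_add, ← Finset.sum_add_distrib, ← Finset.sum_add_distrib, Finset.mul_sum]
    refine Finset.sum_congr rfl fun π _ => ?_
    rw [re_trace_mul_gram hT hCQ p (fun m => π (ι m))]
    congr 1
    rw [← Complex.add_re, ← Complex.add_re, ← Matrix.trace_add, ← Matrix.trace_add]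
    congr 2
    rw [Matrix.mul_sub (codeOp B p _), Matrix.sub_mul _ _ (codeOp B p _)ᴴ]
    noncomm_ring
  rw [e]
  have hN : (0 : ℝ) ≤ Fintype.card (Equiv.Perm A) := by positivity
  have hN' := mul_le_mul_of_nonneg_left hdist hN
  linarith

end Coding

end OneShot
-- The coding theorem: limit of the random coding bound and choice of the permutation.
theorem theorem4 {A B M : Type*} [Fintype A] [DecidableEq A] [Fintype B] [DecidableEq B]
    [Fintype M] [DecidableEq M]
    (hA : 2 ≤ Fintype.card A)
    (T : Matrix A A ℂ →ₗ[ℂ] Matrix B B ℂ) (hT : IsChannel T) (hCQ : IsCQ T)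
    (p : M → ℝ) (hp : ∀ m, 0 ≤ p m) (hp1 : ∑ m, p m = 1)
    (ι : M ↪ A)
    (ε : ℝ) (hε : 0 ≤ ε) (hε1 : ε < 1) :
    ∃ (π : Equiv.Perm A) (D : Matrix B B ℂ →ₗ[ℂ] Matrix M M ℂ), IsChannel D ∧
      traceNorm
          (amplify (D ∘ₗ T) M (conjFirst (permOp π * embedOp ι) (pureState (messageVec p)))
            - classicalize (pureState (messageVec p)))
        ≤ 2 * √(√(1 / ((Fintype.card A : ℝ) - 1) *
            (2 : ℝ) ^ (smoothMaxEntropy ε (choi T)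
              + maxEntropyOne (partialTrace (pureState (messageVec p))))) + 8 * ε) := by

  classical
  have hMne : Nonempty M := by
    by_contra hM
    rw [not_nonempty_iff] at hM
    simp at hp1
  choose F hF hF1 u hu1 hu2 hu using fun π : Equiv.Perm A =>
    exists_measurement hp hp1 (τ := fun m => T (Matrix.single (π (ι m)) (π (ι m)) 1))
      fun m => hT.isState_single _
  set err : Equiv.Perm A → ℝ := fun π =>
    1 - ∑ m, p m * (F π m * T (Matrix.single (π (ι m)) (π (ι m)) 1)).trace.re
  set h₁ := smoothMinEntropy ε (reducedAC (purify (choi T))) with hh₁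
  set h₂ := minEntropy (reducedAC (purify ((partialTrace
      (pureState (messageVec p))).submatrix (Prod.fst : M × Unit → M) Prod.fst))) with hh₂
  set N : ℝ := ((Fintype.card (Equiv.Perm A) : ℕ) : ℝ) with hN
  set d : ℝ := ((Fintype.card A : ℕ) : ℝ) with hd
  -- The bounds hold strictly below the suprema defining the entropies; continuity removes the slack
  -- `η`, so attainment is not needed.
  have hη : ∀ η : ℝ, 0 < η → ∑ π, err π
      ≤ N * (√((2 : ℝ) ^ (-(h₂ - η)) * (2 : ℝ) ^ (-(h₁ - η)) / (d - 1)) + 4 * ε) := fun η h0 =>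
    (Finset.sum_le_sum fun π _ => hu π).trans (sum_re_trace_gram_le hA hT hCQ hp hp1 ι hε hu1 hu2
      (by linarith) (by linarith))
  have hlim : ∑ π, err π ≤ N * (√((2 : ℝ) ^ (-h₂) * (2 : ℝ) ^ (-h₁) / (d - 1)) + 4 * ε) := by
    have hcont : Continuous fun η : ℝ =>
        N * (√((2 : ℝ) ^ (-(h₂ - η)) * (2 : ℝ) ^ (-(h₁ - η)) / (d - 1)) + 4 * ε) := by
      have h2 : ∀ h : ℝ, Continuous fun η : ℝ => (2 : ℝ) ^ (-(h - η)) := fun h =>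
        Continuous.rpow continuous_const (by fun_prop) fun _ => Or.inl (by norm_num)
      exact continuous_const.mul
        (((((h2 h₂).mul (h2 h₁)).div_const _).sqrt).add continuous_const)
    have ht := (hcont.tendsto 0).mono_left (nhdsWithin_le_nhds (s := Set.Ioi (0 : ℝ)))
    simp only [sub_zero] at ht
    exact ge_of_tendsto ht (Filter.eventually_of_mem self_mem_nhdsWithin fun η h0 => hη η h0)
  obtain ⟨π, -, hπ⟩ := Finset.exists_le_of_sum_le (s := (Finset.univ : Finset (Equiv.Perm A)))
    (f := err) (g := fun _ => √((2 : ℝ) ^ (-h₂) * (2 : ℝ) ^ (-h₁) / (d - 1)) + 4 * ε)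
    Finset.univ_nonempty (by rw [Finset.sum_const, nsmul_eq_mul, Finset.card_univ]; exact hlim)
  refine ⟨π, measure (F π), isChannel_measure (hF π) (hF1 π), ?_⟩
  rw [traceNorm_measure_eq hT hCQ hp hp1 ι π (hF π) (hF1 π)]
  have hX : (2 : ℝ) ^ (-h₂) * (2 : ℝ) ^ (-h₁) / (d - 1) = 1 / (d - 1) *
      (2 : ℝ) ^ (smoothMaxEntropy ε (choi T)
        + maxEntropyOne (partialTrace (pureState (messageVec p)))) := by
    rw [smoothMaxEntropy, maxEntropyOne, maxEntropy, ← hh₁, ← hh₂, Real.rpow_add (by norm_num)]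
    ring
  rw [hX] at hπ
  change 2 * err π ≤ _
  refine mul_le_mul_of_nonneg_left ?_ zero_le_two
  have herr1 : err π ≤ 1 := sub_le_self _ (Finset.sum_nonneg fun m _ => mul_nonneg (hp m)
    (re_trace_mul_nonneg (hF π m) (hT.isState_single _).1))
  by_cases h0 : err π ≤ 0
  · exact h0.trans (Real.sqrt_nonneg _)
  · push Not at h0
    -- Since `0 < err π ≤ 1`, `err² ≤ err ≤ √X + 4ε ≤ √X + 8ε`, where `X` is the expression under
    -- the inner root.
    exact Real.le_sqrt_of_sq_le (by nlinarith)
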